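/- Let $\mathrm{Homeo}_+(\mathbb R^2)$ be the group of orientation-preserving homeomorphisms of the plane and $\mathrm{Diff}_+(\mathbb R^2)$ its subgroup of orientation-preserving $C^\infty$ diffeomorphisms. Near infinity, every $f\in\mathrm{Homeo}_+(\mathbb R^2)$ lifts to the universal cover of an annular neighbourhood of infinity; the pairs consisting of an element $f\in\mathrm{Homeo}_+(\mathbb R^2)$ and a germ at infinity of such a lift of $f$ form a central extension of $\mathrm{Homeo}_+(\mathbb R^2)$ by the deck group $\mathbb Z$, and the class $e\in H^2(\mathrm{Homeo}_+(\mathbb R^2);\mathbb Z)$ of this extension (in the cohomology of the discrete group) is the Euler class. For $g\ge 1$ let $S_g$ be the closed oriented surface of genus $g$, so that $$\pi_1(S_g)=\langle a_1,b_1,\dots,a_g,b_g \mid [a_1,b_1]\cdots[a_g,b_g]\rangle ,$$ and let $[S_g]$, the fundamental class, be the generator of $H_2(\pi_1(S_g);\mathbb Z)\cong\mathbb Z$ given by the orientation. The Euler number of a homomorphism $\rho:\pi_1(S_g)\to\mathrm{Homeo}_+(\mathbb R^2)$ is the integer $\rho^*e([S_g])$. **Theorem.** For every $g\ge 2$, for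 either orientation of $S_g$, and for every $n\in\mathbb Z$ there is a homomorphism $\rho:\pi_1(S_g)\to\mathrm{Diff}_+(\mathbb R^2)$ with $\rho^*e([S_g])=n$. -/

import Mathlib

noncomputable section

namespace PlanarEuler

/-! ### Homeomorphisms of the plane and their lifts near infinity

The plane `ℝ²` is identified with `ℂ`. The annulus `{R < |z|}` has universal cover the half plane
`{log R < Re w}`, the covering map being `Complex.exp`; its deck group is generated by the
translation by `2πi`. -/

/-- The generator `2πi` of the deck group of `exp : ℂ → ℂ \ {0}`. -/
def deck : ℂ := 2 * (Real.pi : ℂ) * Complex.I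

/-- `F` is, on the half plane `{r < Re w}`, a continuous lift through `exp` of the restriction of
the homeomorphism `f` of the plane to the annulus `{exp r < |z|}`, and `F` commutes with the deck
group, i.e. `f` wraps circles about infinity once in the positive direction. -/
structure IsLift (f : ℂ ≃ₜ ℂ) (F : ℂ → ℂ) (r : ℝ) : Prop where
  continuousOn : ContinuousOn F {w | r < w.re}
  exp_eq : ∀ w : ℂ, r < w.re → Complex.exp (F w) = f (Complex.exp w)
  map_add_deck : ∀ w : ℂ, r < w.re → F (w + deck) = F w + deck

/-- A homeomorphism of the plane preserves orientation if it has degree `+1` (and not `-1`) on a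
neighbourhood of infinity. -/
def OrientationPreserving (f : ℂ ≃ₜ ℂ) : Prop :=
  ∃ (F : ℂ → ℂ) (r : ℝ), IsLift f F r

lemma deck_re : deck.re = 0 := by simp [deck]

lemma deck_ne_zero : deck ≠ 0 := by
  simp [deck, Real.pi_ne_zero]

lemma int_deck_re (k : ℤ) : ((k : ℂ) * deck).re = 0 := by simp [deck]

lemma exp_add_int_deck (w : ℂ) (k : ℤ) : Complex.exp (w + k * deck) = Complex.exp w :=
  Complex.exp_eq_exp_iff_exists_int.2 ⟨k, by simp [deck]⟩

lemma IsLift.map_add_int {f : ℂ ≃ₜ ℂ} {F : ℂ → ℂ} {r : ℝ} (h : IsLift f F r) (k : ℤ)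
    (w : ℂ) (hw : r < w.re) : F (w + k * deck) = F w + k * deck := by
  have nat : ∀ (n : ℕ) (w : ℂ), r < w.re → F (w + n * deck) = F w + n * deck := by
    intro n
    induction n with
    | zero => intro w _; simp
    | succ n ih =>
      intro w hw
      have h1 : r < (w + n * deck).re := by
        have := int_deck_re n
        push_cast at this
        rw [Complex.add_re, this]; simpa using hw
      have := h.map_add_deck _ h1
      rw [ih w hw] at this
      push_cast
      rw [show w + ((n : ℂ) + 1) * deck = w + n * deck + deck by ring, this]
      ring
  obtain ⟨n, rfl | rfl⟩ := k.eq_nat_or_neg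
  · exact_mod_cast nat n w hw
  · have h1 : r < (w + ((-(n : ℤ) : ℤ) : ℂ) * deck).re := by
      rw [Complex.add_re, int_deck_re]; simpa using hw
    have := nat n _ h1
    push_cast at this ⊢
    rw [show w + -(n : ℂ) * deck + n * deck = w by ring] at this
    rw [this]; ring

lemma IsLift.mono {f : ℂ ≃ₜ ℂ} {F : ℂ → ℂ} {r s : ℝ} (h : IsLift f F r) (hrs : r ≤ s) :
    IsLift f F s :=
  ⟨h.continuousOn.mono fun _ hw => lt_of_le_of_lt hrs hw,
    fun w hw => h.exp_eq w (lt_of_le_of_lt hrs hw),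
    fun w hw => h.map_add_deck w (lt_of_le_of_lt hrs hw)⟩

/-- A homeomorphism of the plane maps neighbourhoods of infinity into neighbourhoods of infinity. -/
lemma exists_norm_gt (f : ℂ ≃ₜ ℂ) (s : ℝ) :
    ∃ r : ℝ, ∀ w : ℂ, r < w.re → Real.exp s < ‖f (Complex.exp w)‖ := by
  have hK : IsCompact (f.symm '' Metric.closedBall 0 (Real.exp s)) :=
    (isCompact_closedBall _ _).image f.symm.continuous
  obtain ⟨C, hC⟩ := hK.isBounded.exists_norm_le
  refine ⟨C, fun w hw => ?_⟩
  by_contra! hle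
  have h1 := hC (Complex.exp w) ⟨f (Complex.exp w), by simpa using hle, by simp⟩
  rw [Complex.norm_exp] at h1
  have h2 := Real.add_one_le_exp w.re
  linarith

/-- A lift maps half planes into half planes. -/
lemma IsLift.exists_re_gt {f : ℂ ≃ₜ ℂ} {F : ℂ → ℂ} {r : ℝ} (h : IsLift f F r) (s : ℝ) :
    ∃ t : ℝ, r ≤ t ∧ ∀ w : ℂ, t < w.re → s < (F w).re := by
  obtain ⟨t, ht⟩ := exists_norm_gt f s
  refine ⟨max r t, le_max_left _ _, fun w hw => ?_⟩
  have h1 := ht w (lt_of_le_of_lt (le_max_right _ _) hw)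
  rw [← h.exp_eq w (lt_of_le_of_lt (le_max_left _ _) hw), Complex.norm_exp] at h1
  exact Real.exp_lt_exp.1 h1

lemma isLift_one : IsLift 1 id 0 :=
  ⟨continuousOn_id, fun _ _ => rfl, fun _ _ => rfl⟩

lemma IsLift.exists_comp {f g : ℂ ≃ₜ ℂ} {F G : ℂ → ℂ} {r s : ℝ}
    (hF : IsLift f F r) (hG : IsLift g G s) : ∃ t, IsLift (f * g) (F ∘ G) t := by
  obtain ⟨t, hst, ht⟩ := hG.exists_re_gt r
  refine ⟨t, hF.continuousOn.comp (hG.mono hst).continuousOn fun w hw => ht w hw, ?_, ?_⟩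
  · intro w hw
    rw [Function.comp_apply, hF.exp_eq _ (ht w hw), (hG.mono hst).exp_eq w hw]
    rfl
  · intro w hw
    rw [Function.comp_apply, (hG.mono hst).map_add_deck w hw, hF.map_add_deck _ (ht w hw)]
    rfl

/-- A continuous function on a connected set with values in `2πiℤ` is constant. -/
lemma exists_int_of_exp_eq {F G : ℂ → ℂ} {r : ℝ} (hF : ContinuousOn F {w | r < w.re})
    (hG : ContinuousOn G {w | r < w.re})
    (h : ∀ w : ℂ, r < w.re → Complex.exp (F w) = Complex.exp (G w)) :
    ∃ k : ℤ, ∀ w : ℂ, r < w.re → F w = G w + k * deck := by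
  have hc : IsPreconnected {w : ℂ | r < w.re} := (convex_halfSpace_re_gt r).isPreconnected
  have hk : ∀ w : ℂ, ∃ k : ℤ, r < w.re → F w = G w + k * deck := by
    intro w
    by_cases hw : r < w.re
    · obtain ⟨k, hk⟩ := Complex.exp_eq_exp_iff_exists_int.1 (h w hw)
      exact ⟨k, fun _ => by simpa [deck] using hk⟩
    · exact ⟨0, fun h => absurd h hw⟩
  choose k hk using hk
  have hcont : ContinuousOn k {w | r < w.re} := by
    have h1 : ContinuousOn (fun w => (k w : ℝ)) {w | r < w.re} := by
      have h2 : ContinuousOn (fun w => ((F w - G w) / deck).re) {w | r < w.re} :=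
        Complex.continuous_re.comp_continuousOn ((hF.sub hG).div_const _)
      refine h2.congr fun w hw => ?_
      simp only [hk w hw, add_sub_cancel_left, mul_div_cancel_right₀ _ deck_ne_zero]
      simp
    exact Int.isClosedEmbedding_coe_real.isInducing.continuousOn_iff.2 h1
  refine ⟨k ((r + 1 : ℝ) : ℂ), fun w hw => ?_⟩
  have := hc.constant hcont hw (show r < (((r + 1 : ℝ) : ℂ)).re by simp)
  rw [hk w hw, this]

/-- The inverse of a homeomorphism with a lift has a lift. -/
lemma IsLift.exists_inv {f : ℂ ≃ₜ ℂ} {F : ℂ → ℂ} {r : ℝ} (hF : IsLift f F r) :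
    ∃ G t, IsLift f⁻¹ G t := by
  obtain ⟨t, ht⟩ := exists_norm_gt f⁻¹ r
  -- a set-theoretic inverse of `F`
  have hex : ∀ u : ℂ, ∃ w : ℂ, t < u.re →
      r < w.re ∧ F w = u ∧ Complex.exp w = f⁻¹ (Complex.exp u) := by
    intro u
    by_cases hu : t < u.re
    · have h0 : f⁻¹ (Complex.exp u) ≠ 0 := by
        have := (Real.exp_pos r).trans (ht u hu)
        exact norm_pos_iff.1 this
      obtain ⟨w, hw⟩ : ∃ w, Complex.exp w = f⁻¹ (Complex.exp u) :=
        ⟨Complex.log _, Complex.exp_log h0⟩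
      have hwr : r < w.re := by
        have := ht u hu
        rw [← hw, Complex.norm_exp] at this
        exact Real.exp_lt_exp.1 this
      have h1 : Complex.exp (F w) = Complex.exp u := by
        rw [hF.exp_eq w hwr, hw]
        exact f.apply_symm_apply _
      obtain ⟨k, hk⟩ := Complex.exp_eq_exp_iff_exists_int.1 h1
      refine ⟨w + ((-k : ℤ) : ℂ) * deck, fun _ => ⟨?_, ?_, ?_⟩⟩
      · rw [Complex.add_re, int_deck_re]; simpa using hwr
      · rw [hF.map_add_int _ _ hwr, hk]; push_cast; simp only [deck]; ring
      · rw [exp_add_int_deck, hw]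
    · exact ⟨0, fun h => absurd h hu⟩
  choose G hG using hex
  -- points with the same image under `F` and under `exp ∘ F` agree
  have hinj : ∀ w w' : ℂ, r < w.re → Complex.exp w = Complex.exp w' → F w = F w' → w' = w := by
    intro w w' hw he hFw
    obtain ⟨k, hk⟩ := Complex.exp_eq_exp_iff_exists_int.1 he.symm
    have hk' : w' = w + (k : ℂ) * deck := by simpa [deck] using hk
    rw [hk', hF.map_add_int k w hw] at hFw
    have : (k : ℂ) * deck = 0 := by simpa using hFw
    rw [hk', this, add_zero]
  refine ⟨G, t, ?_, fun u hu => (hG u hu).2.2, ?_⟩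
  · intro u₀ hu₀
    have hu₀' : t < u₀.re := hu₀
    obtain ⟨hr₀, hF₀, he₀⟩ := hG u₀ hu₀'
    refine ContinuousAt.continuousWithinAt ?_
    -- a local branch of `log (f⁻¹ (exp u))`
    set L : ℂ → ℂ := fun u => G u₀ + Complex.log (f⁻¹ (Complex.exp u) / Complex.exp (G u₀)) with hL
    have hquot : ContinuousAt (fun u => f⁻¹ (Complex.exp u) / Complex.exp (G u₀)) u₀ := by
      have : Continuous (fun u => f⁻¹ (Complex.exp u)) :=
        (f⁻¹).continuous.comp Complex.continuous_exp
      exact this.continuousAt.div_const _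
    have hq1 : f⁻¹ (Complex.exp u₀) / Complex.exp (G u₀) = 1 := by
      rw [← he₀, div_self (Complex.exp_ne_zero _)]
    have hLc : ContinuousAt L u₀ :=
      continuousAt_const.add (hquot.clog (by rw [hq1]; exact Complex.one_mem_slitPlane))
    have hL0 : L u₀ = G u₀ := by
      rw [hL]; simp only; rw [hq1, Complex.log_one, add_zero]
    have hopen : ∀ᶠ u in nhds u₀, t < u.re :=
      (isOpen_lt continuous_const Complex.continuous_re).mem_nhds hu₀'
    have hLexp : ∀ᶠ u in nhds u₀, Complex.exp (L u) = f⁻¹ (Complex.exp u) := by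
      filter_upwards [hopen] with u hu
      have h0 : f⁻¹ (Complex.exp u) ≠ 0 := by
        rw [← (hG u hu).2.2]; exact Complex.exp_ne_zero _
      rw [hL]
      simp only
      rw [Complex.exp_add, Complex.exp_log (div_ne_zero h0 (Complex.exp_ne_zero _)),
        mul_div_cancel₀ _ (Complex.exp_ne_zero _)]
    have hLr : ∀ᶠ u in nhds u₀, r < (L u).re :=
      (Complex.continuous_re.continuousAt.comp hLc).eventually
        (lt_mem_nhds (by simpa [hL0] using hr₀))
    have hFc : ContinuousAt F (L u₀) := by
      rw [hL0]
      exact hF.continuousOn.continuousAt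
        ((isOpen_lt continuous_const Complex.continuous_re).mem_nhds hr₀)
    have hD : ContinuousAt (fun u => F (L u) - u) u₀ := (hFc.comp hLc).sub continuousAt_id
    have hDs : ∀ᶠ u in nhds u₀, ‖F (L u) - u‖ < 1 := by
      have h0 : ‖F (L u₀) - u₀‖ < 1 := by simp [hL0, hF₀]
      exact hD.norm.eventually (gt_mem_nhds h0)
    refine hLc.congr ?_
    filter_upwards [hopen, hLexp, hLr, hDs] with u hu h1 h2 h3
    obtain ⟨hru, hFu, heu⟩ := hG u hu
    have hFL : Complex.exp (F (L u)) = Complex.exp u := by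
      rw [hF.exp_eq _ h2, h1]
      exact f.apply_symm_apply _
    obtain ⟨k, hk⟩ := Complex.exp_eq_exp_iff_exists_int.1 hFL
    have hk0 : k = 0 := by
      rw [hk, add_sub_cancel_left] at h3
      have h4 : ‖(k : ℂ) * (2 * Real.pi * Complex.I)‖ = |(k : ℝ)| * (2 * Real.pi) := by
        simp [abs_of_pos Real.pi_pos]
      rw [h4] at h3
      have h5 : |(k : ℝ)| < 1 := by
        have := Real.two_le_pi
        nlinarith [abs_nonneg (k : ℝ)]
      exact Int.abs_lt_one_iff.1 (by exact_mod_cast h5)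
    rw [hk0] at hk
    exact hinj _ _ hru (by rw [heu, h1]) (by rw [hFu, hk]; simp)
  · intro u hu
    obtain ⟨hru, hFu, heu⟩ := hG u hu
    have hu' : t < (u + deck).re := by rw [Complex.add_re, deck_re]; simpa using hu
    obtain ⟨hru', hFu', heu'⟩ := hG _ hu'
    have hre : r < (G u + deck).re := by rw [Complex.add_re, deck_re]; simpa using hru
    have he : Complex.exp (G u + deck) = Complex.exp (G u) := by
      simpa using exp_add_int_deck (G u) 1
    refine hinj _ _ hre ?_ ?_
    · rw [he, heu, heu']
      have : Complex.exp (u + deck) = Complex.exp u := by simpa using exp_add_int_deck u 1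
      rw [this]
    · rw [hF.map_add_deck _ hru, hFu, hFu']

/-- The group `Homeo₊(ℝ²)` of orientation preserving homeomorphisms of the plane. -/
def HomeoPlus : Subgroup (ℂ ≃ₜ ℂ) where
  carrier := {f | OrientationPreserving f}
  one_mem' := ⟨id, 0, isLift_one⟩
  mul_mem' := by
    rintro f g ⟨F, r, hF⟩ ⟨G, s, hG⟩
    exact ⟨F ∘ G, hF.exists_comp hG⟩
  inv_mem' := by
    rintro f ⟨F, r, hF⟩
    exact hF.exists_inv

/-- The group `Diff₊(ℝ²)` of orientation preserving `C^∞` diffeomorphisms of the plane. (For a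
diffeomorphism the sign condition on the Jacobian and membership in `HomeoPlus` are two
formulations of the preservation of orientation; both are imposed.) -/
def DiffPlus : Subgroup (ℂ ≃ₜ ℂ) where
  carrier := {f | f ∈ HomeoPlus ∧ ContDiff ℝ (⊤ : ℕ∞) f ∧ ContDiff ℝ (⊤ : ℕ∞) f.symm ∧
    ∀ z : ℂ, 0 < (fderiv ℝ f z).det}
  one_mem' := by
    refine ⟨one_mem _, contDiff_id, contDiff_id, fun z => ?_⟩
    have : fderiv ℝ ((1 : ℂ ≃ₜ ℂ) : ℂ → ℂ) z = ContinuousLinearMap.id ℝ ℂ := fderiv_id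
    rw [this]
    simp [ContinuousLinearMap.det]
  mul_mem' := by
    rintro f g ⟨hf, hf1, hf2, hf3⟩ ⟨hg, hg1, hg2, hg3⟩
    refine ⟨mul_mem hf hg, hf1.comp hg1, hg2.comp hf2, fun z => ?_⟩
    have h1 : fderiv ℝ ((f * g : ℂ ≃ₜ ℂ) : ℂ → ℂ) z =
        (fderiv ℝ f (g z)).comp (fderiv ℝ g z) :=
      fderiv_comp z (hf1.differentiable (by simp) _) (hg1.differentiable (by simp) _)
    rw [h1]
    have h2 : ((fderiv ℝ f (g z)).comp (fderiv ℝ g z)).det =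
        (fderiv ℝ f (g z)).det * (fderiv ℝ g z).det := LinearMap.det_comp _ _
    rw [h2]
    exact mul_pos (hf3 _) (hg3 _)
  inv_mem' := by
    rintro f ⟨hf, hf1, hf2, hf3⟩
    refine ⟨inv_mem hf, hf2, hf1, fun z => ?_⟩
    have h1 : (fderiv ℝ f (f.symm z)).comp (fderiv ℝ f.symm z) = ContinuousLinearMap.id ℝ ℂ := by
      rw [← fderiv_comp z (hf1.differentiable (by simp) _) (hf2.differentiable (by simp) _)]
      have : (f ∘ f.symm : ℂ → ℂ) = id := by ext x; simp
      rw [this, fderiv_id]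
    have h2 : (fderiv ℝ f (f.symm z)).det * (fderiv ℝ f.symm z).det = 1 := by
      have h3 : ((fderiv ℝ f (f.symm z)).comp (fderiv ℝ f.symm z)).det =
        (fderiv ℝ f (f.symm z)).det * (fderiv ℝ f.symm z).det := LinearMap.det_comp _ _
      rw [← h3, h1]
      simp [ContinuousLinearMap.det]
    have h4 := hf3 (f.symm z)
    change 0 < (fderiv ℝ f.symm z).det
    by_contra! h5
    nlinarith

lemma diffPlus_le_homeoPlus : DiffPlus ≤ HomeoPlus := fun _ h => h.1

/-! ### The Euler class

Germs at infinity of lifts of elements of `Homeo₊(ℝ²)` form a central extension of `Homeo₊(ℝ²)`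
by the deck group `ℤ`; it is pulled back from the group of germs at infinity of elements of
`Homeo₊(ℝ²)`. Its class in `H²(Homeo₊(ℝ²); ℤ)` (discrete group cohomology) is represented by the
factor set of any set-theoretic section, i.e. of any choice of lifts. -/

/-- A choice of lift for each orientation preserving homeomorphism. -/
def chosenLift (f : HomeoPlus) : ℂ → ℂ := f.2.choose

lemma chosenLift_spec (f : HomeoPlus) : ∃ r, IsLift f (chosenLift f) r := f.2.choose_spec

lemma exists_factor (f g : HomeoPlus) : ∃ k : ℤ, ∃ r : ℝ, ∀ w : ℂ, r < w.re →
    chosenLift f (chosenLift g w) = chosenLift (f * g) w + k * deck := by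
  obtain ⟨r, hr⟩ := chosenLift_spec f
  obtain ⟨s, hs⟩ := chosenLift_spec g
  obtain ⟨t, ht⟩ := chosenLift_spec (f * g)
  obtain ⟨u, hu⟩ := hr.exists_comp hs
  have h1 := hu.mono (le_max_left u t)
  have h2 := ht.mono (le_max_right u t)
  obtain ⟨k, hk⟩ := exists_int_of_exp_eq h1.continuousOn h2.continuousOn
    (fun w hw => by rw [h1.exp_eq w hw, h2.exp_eq w hw]; rfl)
  exact ⟨k, _, hk⟩

/-- The factor set of the section `chosenLift`: the integer `k` such that near infinity
`f̃ ∘ g̃ = (f ∘ g)~ + k · 2πi`. -/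
def factorSet (p : HomeoPlus × HomeoPlus) : ℤ := (exists_factor p.1 p.2).choose

lemma factorSet_spec (f g : HomeoPlus) : ∃ r : ℝ, ∀ w : ℂ, r < w.re →
    chosenLift f (chosenLift g w) = chosenLift (f * g) w + factorSet (f, g) * deck :=
  (exists_factor f g).choose_spec

lemma factorSet_mem : factorSet ∈
    groupCohomology.cocycles₂ (Rep.trivial ℤ HomeoPlus ℤ) := by
  refine (groupCohomology.mem_cocycles₂_iff (A := Rep.trivial ℤ HomeoPlus ℤ) factorSet).2 ?_
  intro f g h
  change factorSet (f * g, h) + factorSet (f, g) = factorSet (g, h) + factorSet (f, g * h)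
  obtain ⟨rf, hf⟩ := chosenLift_spec f
  obtain ⟨rh, hh⟩ := chosenLift_spec h
  obtain ⟨rgh, hgh⟩ := chosenLift_spec (g * h)
  obtain ⟨a, ha⟩ := factorSet_spec f g
  obtain ⟨b, hb⟩ := factorSet_spec (f * g) h
  obtain ⟨c, hc⟩ := factorSet_spec g h
  obtain ⟨d, hd⟩ := factorSet_spec f (g * h)
  obtain ⟨t, -, ht⟩ := hh.exists_re_gt a
  obtain ⟨u, -, hu⟩ := hgh.exists_re_gt rf
  obtain ⟨w, hw⟩ : ∃ w : ℂ, max (max b c) (max d (max t u)) < w.re :=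
    ⟨((max (max b c) (max d (max t u)) + 1 : ℝ) : ℂ), by rw [Complex.ofReal_re]; linarith⟩
  simp only [max_lt_iff] at hw
  obtain ⟨⟨hwb, hwc⟩, hwd, hwt, hwu⟩ := hw
  have e1 : chosenLift f (chosenLift g (chosenLift h w)) =
      chosenLift (f * g * h) w + factorSet (f * g, h) * deck + factorSet (f, g) * deck := by
    rw [ha _ (ht w hwt), hb w hwb]
  have e2 : chosenLift f (chosenLift g (chosenLift h w)) =
      chosenLift (f * (g * h)) w + factorSet (f, g * h) * deck + factorSet (g, h) * deck := by
    rw [hc w hwc, hf.map_add_int _ _ (hu w hwu), hd w hwd]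
  rw [e1, mul_assoc f g h] at e2
  have e3 : ((factorSet (f * g, h) + factorSet (f, g) : ℤ) : ℂ) * deck =
      ((factorSet (g, h) + factorSet (f, g * h) : ℤ) : ℂ) * deck := by
    push_cast
    linear_combination e2
  exact_mod_cast mul_right_cancel₀ deck_ne_zero e3

/-- The Euler class `e ∈ H²(Homeo₊(ℝ²); ℤ)`. -/
def eulerClass : groupCohomology.H2 (Rep.trivial ℤ HomeoPlus ℤ) :=
  groupCohomology.H2π (Rep.trivial ℤ HomeoPlus ℤ) ⟨factorSet, factorSet_mem⟩

section

open CategoryTheory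

/-- The pullback `ρ^*e ∈ H²(G; ℤ)` of the Euler class by an action `ρ : G → Homeo₊(ℝ²)`. -/
def pullbackEulerClass {G : Type} [Group G] (ρ : G →* HomeoPlus) :
    groupCohomology.H2 (Rep.trivial ℤ G ℤ) :=
  groupCohomology.map ρ
    (𝟙 (Rep.trivial ℤ G ℤ) : Rep.res ρ (Rep.trivial ℤ HomeoPlus ℤ) ⟶ Rep.trivial ℤ G ℤ) 2
    eulerClass

end

/-! ### Evaluation of `H²(G; ℤ)` on `H₂(G; ℤ)` -/

section Pairing

/-- Evaluation of a function on `G × G` on the chains of the bar complex: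
`∑ nᵢ [gᵢ | hᵢ] ↦ ∑ nᵢ f(gᵢ, hᵢ)`. -/
def evalChain (G : Type) : (G × G → ℤ) →ₗ[ℤ] (G × G →₀ ℤ) →ₗ[ℤ] ℤ where
  toFun f := Finsupp.linearCombination ℤ f
  map_add' f f' := by ext; simp
  map_smul' a f := by ext; simp

lemma evalChain_single (G : Type) (f : G × G → ℤ) (p : G × G) (a : ℤ) :
    evalChain G f (Finsupp.single p a) = a * f p := by
  simp [evalChain]

variable (G : Type) [Group G]

lemma cohomologyπ_surjective :
    Function.Surjective (groupCohomology.H2π (Rep.trivial ℤ G ℤ)).hom :=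
  (ModuleCat.epi_iff_surjective _).1 inferInstance

lemma homologyπ_surjective :
    Function.Surjective (groupHomology.H2π (Rep.trivial ℤ G ℤ)).hom :=
  (ModuleCat.epi_iff_surjective _).1 inferInstance

/-- A cocycle vanishes on boundaries. -/
lemma evalChain_boundary (f : G × G → ℤ)
    (hf : f ∈ groupCohomology.cocycles₂ (Rep.trivial ℤ G ℤ)) (z : G × G →₀ ℤ)
    (hz : z ∈ groupHomology.boundaries₂ (Rep.trivial ℤ G ℤ)) : evalChain G f z = 0 := by
  obtain ⟨y, rfl⟩ := hz
  have h : (evalChain G f) ∘ₗ (groupHomology.d₃₂ (Rep.trivial ℤ G ℤ)).hom = 0 := by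
    refine Finsupp.lhom_ext fun p a => ?_
    obtain ⟨x, y, z⟩ := p
    have h1 := (groupCohomology.mem_cocycles₂_iff (A := Rep.trivial ℤ G ℤ) f).1 hf x y z
    have h2 : f (x * y, z) + f (x, y) = f (y, z) + f (x, y * z) := h1
    have h3 : (groupHomology.d₃₂ (Rep.trivial ℤ G ℤ)).hom (Finsupp.single (x, y, z) a) =
        (Finsupp.single (y, z) a - Finsupp.single (x * y, z) a + Finsupp.single (x, y * z) a -
          Finsupp.single (x, y) a : G × G →₀ ℤ) :=
      groupHomology.d₃₂_single (A := Rep.trivial ℤ G ℤ) (x, y, z) a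
    change evalChain G f ((groupHomology.d₃₂ (Rep.trivial ℤ G ℤ)).hom
      (Finsupp.single (x, y, z) a)) = 0
    rw [h3, map_sub, map_add, map_sub, evalChain_single, evalChain_single, evalChain_single,
      evalChain_single]
    change ℤ at a
    linear_combination (-a) * h2
  exact LinearMap.congr_fun h y

/-- A coboundary vanishes on cycles. -/
lemma evalChain_coboundary (f : G × G → ℤ)
    (hf : f ∈ groupCohomology.coboundaries₂ (Rep.trivial ℤ G ℤ)) (z : G × G →₀ ℤ)
    (hz : z ∈ groupHomology.cycles₂ (Rep.trivial ℤ G ℤ)) : evalChain G f z = 0 := by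
  obtain ⟨y, rfl⟩ := hf
  have h : (evalChain G ((groupCohomology.d₁₂ (Rep.trivial ℤ G ℤ)).hom y)) =
      (Finsupp.linearCombination ℤ y) ∘ₗ (groupHomology.d₂₁ (Rep.trivial ℤ G ℤ)).hom := by
    refine Finsupp.lhom_ext fun p a => ?_
    obtain ⟨x, w⟩ := p
    have h3 : (groupHomology.d₂₁ (Rep.trivial ℤ G ℤ)).hom (Finsupp.single (x, w) a) =
        (Finsupp.single w a - Finsupp.single (x * w) a + Finsupp.single x a : G →₀ ℤ) :=
      groupHomology.d₂₁_single (A := Rep.trivial ℤ G ℤ) (x, w) a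
    change _ = Finsupp.linearCombination ℤ y ((groupHomology.d₂₁ (Rep.trivial ℤ G ℤ)).hom
      (Finsupp.single (x, w) a))
    rw [h3, evalChain_single, map_add, map_sub, Finsupp.linearCombination_single,
      Finsupp.linearCombination_single, Finsupp.linearCombination_single]
    have h4 : (groupCohomology.d₁₂ (Rep.trivial ℤ G ℤ)).hom y (x, w) =
      y w - y (x * w) + y x := rfl
    rw [h4]
    simp only [smul_eq_mul]
    ring
  have hz' : (groupHomology.d₂₁ (Rep.trivial ℤ G ℤ)).hom z = 0 := hz
  rw [h, LinearMap.comp_apply, hz', map_zero]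

/-- The map induced on the target of a surjective linear map. -/
def descend {R M N P : Type} [CommRing R] [AddCommGroup M] [AddCommGroup N] [AddCommGroup P]
    [Module R M] [Module R N] [Module R P]
    (p : M →ₗ[R] N) (hp : Function.Surjective p) (u : M →ₗ[R] P)
    (h : LinearMap.ker p ≤ LinearMap.ker u) : N →ₗ[R] P :=
  (LinearMap.ker p).liftQ u h ∘ₗ (p.quotKerEquivOfSurjective hp).symm.toLinearMap

lemma descend_apply {R M N P : Type} [CommRing R] [AddCommGroup M] [AddCommGroup N] [AddCommGroup P]
    [Module R M] [Module R N] [Module R P]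
    (p : M →ₗ[R] N) (hp : Function.Surjective p) (u : M →ₗ[R] P)
    (h : LinearMap.ker p ≤ LinearMap.ker u) (m : M) : descend p hp u h (p m) = u m := by
  have : (p.quotKerEquivOfSurjective hp).symm (p m) = Submodule.Quotient.mk m := by
    rw [LinearEquiv.symm_apply_eq]; rfl
  simp [descend, this]

lemma ker_homologyπ_le (f : groupCohomology.cocycles₂ (Rep.trivial ℤ G ℤ)) :
    LinearMap.ker (groupHomology.H2π (Rep.trivial ℤ G ℤ)).hom ≤
      LinearMap.ker (evalChain G f.1 ∘ₗ
        (groupHomology.cycles₂ (Rep.trivial ℤ G ℤ)).subtype) := by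
  intro z hz
  exact evalChain_boundary G f.1 f.2 z.1
    ((groupHomology.H2π_eq_zero_iff (A := Rep.trivial ℤ G ℤ) z).1 (LinearMap.mem_ker.1 hz))

/-- Evaluation of a cocycle on homology classes. -/
def evalCocycleFun (f : groupCohomology.cocycles₂ (Rep.trivial ℤ G ℤ)) :
    groupHomology.H2 (Rep.trivial ℤ G ℤ) →ₗ[ℤ] ℤ :=
  descend (groupHomology.H2π (Rep.trivial ℤ G ℤ)).hom (homologyπ_surjective G)
    (evalChain G f.1 ∘ₗ (groupHomology.cycles₂ (Rep.trivial ℤ G ℤ)).subtype)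
    (ker_homologyπ_le G f)

lemma evalCocycleFun_apply (f : groupCohomology.cocycles₂ (Rep.trivial ℤ G ℤ))
    (z : groupHomology.cycles₂ (Rep.trivial ℤ G ℤ)) :
    evalCocycleFun G f ((groupHomology.H2π (Rep.trivial ℤ G ℤ)).hom z) = evalChain G f.1 z.1 :=
  descend_apply (groupHomology.H2π (Rep.trivial ℤ G ℤ)).hom (homologyπ_surjective G)
    (evalChain G f.1 ∘ₗ (groupHomology.cycles₂ (Rep.trivial ℤ G ℤ)).subtype)
    (ker_homologyπ_le G f) z

/-- Evaluation of cocycles on homology classes, as a linear map. -/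
def evalCocycle : groupCohomology.cocycles₂ (Rep.trivial ℤ G ℤ) →ₗ[ℤ]
    (groupHomology.H2 (Rep.trivial ℤ G ℤ) →ₗ[ℤ] ℤ) where
  toFun := evalCocycleFun G
  map_add' f f' := by
    refine LinearMap.ext fun c => ?_
    obtain ⟨z, rfl⟩ := homologyπ_surjective G c
    rw [LinearMap.add_apply, evalCocycleFun_apply, evalCocycleFun_apply, evalCocycleFun_apply]
    exact LinearMap.congr_fun (map_add (evalChain G) f.1 f'.1) z.1
  map_smul' a f := by
    refine LinearMap.ext fun c => ?_
    obtain ⟨z, rfl⟩ := homologyπ_surjective G c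
    rw [LinearMap.smul_apply, evalCocycleFun_apply, evalCocycleFun_apply]
    exact LinearMap.congr_fun (map_smul (evalChain G) a f.1) z.1

lemma ker_cohomologyπ_le :
    LinearMap.ker (groupCohomology.H2π (Rep.trivial ℤ G ℤ)).hom ≤
      LinearMap.ker (evalCocycle G) := by
  intro f hf
  rw [LinearMap.mem_ker]
  refine LinearMap.ext fun c => ?_
  obtain ⟨z, rfl⟩ := homologyπ_surjective G c
  refine (evalCocycleFun_apply G f z).trans ?_
  exact evalChain_coboundary G f.1
    ((groupCohomology.H2π_eq_zero_iff (A := Rep.trivial ℤ G ℤ) f).1 (LinearMap.mem_ker.1 hf))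
    z.1 z.2

/-- The Kronecker pairing `H²(G; ℤ) × H₂(G; ℤ) → ℤ`. -/
def kronecker : groupCohomology.H2 (Rep.trivial ℤ G ℤ) →ₗ[ℤ]
    (groupHomology.H2 (Rep.trivial ℤ G ℤ) →ₗ[ℤ] ℤ) :=
  descend (groupCohomology.H2π (Rep.trivial ℤ G ℤ)).hom (cohomologyπ_surjective G)
    (evalCocycle G) (ker_cohomologyπ_le G)

/-- The Kronecker pairing of the classes of a cocycle `f` and of a cycle `z` is the evaluation of
`f` on `z`. -/
lemma kronecker_apply (f : groupCohomology.cocycles₂ (Rep.trivial ℤ G ℤ))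
    (z : groupHomology.cycles₂ (Rep.trivial ℤ G ℤ)) :
    kronecker G (groupCohomology.H2π (Rep.trivial ℤ G ℤ) f)
      (groupHomology.H2π (Rep.trivial ℤ G ℤ) z) = evalChain G f.1 z.1 := by
  have h : kronecker G (groupCohomology.H2π (Rep.trivial ℤ G ℤ) f) = evalCocycle G f :=
    descend_apply (groupCohomology.H2π (Rep.trivial ℤ G ℤ)).hom (cohomologyπ_surjective G)
      (evalCocycle G) (ker_cohomologyπ_le G) f
  rw [h]
  exact evalCocycleFun_apply G f z

end Pairing

/-! ### Surface groups and Euler numbers -/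

/-- The word `[a₁, b₁] ⋯ [a_g, b_g]`, where `[a, b] = a b a⁻¹ b⁻¹`; the generator `aᵢ` is indexed
by `Sum.inl i` and `bᵢ` by `Sum.inr i`. -/
def surfaceRelator (g : ℕ) : FreeGroup (Fin g ⊕ Fin g) :=
  (List.ofFn fun i : Fin g =>
    FreeGroup.of (Sum.inl i) * FreeGroup.of (Sum.inr i) *
      (FreeGroup.of (Sum.inl i))⁻¹ * (FreeGroup.of (Sum.inr i))⁻¹).prod

/-- The fundamental group of the closed orientable surface of genus `g`, in its standard
presentation `⟨a₁, b₁, …, a_g, b_g | [a₁, b₁] ⋯ [a_g, b_g]⟩`. -/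
abbrev SurfaceGroup (g : ℕ) : Type :=
  PresentedGroup ({surfaceRelator g} : Set (FreeGroup (Fin g ⊕ Fin g)))

/-- The fundamental classes of the surface of genus `g ≥ 1`, for its two orientations: the
generators of the infinite cyclic group `H₂(π₁(S_g); ℤ)`. -/
def IsFundamentalClass (g : ℕ)
    (c : groupHomology.H2 (Rep.trivial ℤ (SurfaceGroup g) ℤ)) : Prop :=
  Submodule.span ℤ {c} = ⊤

/-- The Euler number `ρ^*e([S_g])` of an action of the surface group, where `c = [S_g]`. -/
def eulerNumber {g : ℕ} (c : groupHomology.H2 (Rep.trivial ℤ (SurfaceGroup g) ℤ))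
    (ρ : SurfaceGroup g →* HomeoPlus) : ℤ :=
  kronecker (SurfaceGroup g) (pullbackEulerClass ρ) c

end PlanarEuler

end

noncomputable section

namespace PlanarEuler

open Filter Topology

/-! ### Comparison of lifts with the chosen lifts -/

/-! Write `D` for the dilation by `√e` and `S` for the spiral twist, which far out rotates the
circle `|z|² = u` by the angle `-2πN log u`. Since `D` increases `log u` by `1`, the commutator `[D,
S]` far out rotates every circle by exactly `2πN`. It is therefore a diffeomorphism `R` supported in
a disc (`dilation_mul_spiral`, `ringAngle_of_nine_le`), while the commutator of the lifts of `D` and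
`S` is the translation by `N · 2πi` near infinity.

The defect `R` is cancelled by an infinite swindle. Let `T` be a translation so long that the discs
`Tᵏ(supp R)` are disjoint, and let `P = ∏_{k ≥ 0} Tᵏ R T⁻ᵏ`. Then `P = R · T P T⁻¹`, so `[T, P] =
R⁻¹` (`spread_add_eight`). Both `T` and `P` are at bounded distance from the identity, so they have
lifts whose displacement tends to zero. These lifts commute near infinity, and the second commutator
contributes nothing (`smallLift_commute`). Sending `a₁, b₁, a₂, b₂` to `D, S, T, P` and all other
generators to `1` gives an action of Euler number `-N` on the standard cycle.

The link with group cohomology is `sum_factorSet_eq`: on the bar cycle of `∏ [xᵢ, yᵢ] = 1`, with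
each commutator trivial near infinity, the Euler cocycle counts the deck translations `[x̃ᵢ, ỹᵢ]`,
up to sign. That the standard cycle generates `H₂` need not be known beforehand; the value at `N =
-1` forces it to be plus or minus the given generator. -/

/-- The filter of neighbourhoods of `Re w = +∞`. -/
def rightEnd : Filter ℂ := comap Complex.re atTop

instance : rightEnd.NeBot := by
  refine comap_neBot_iff.2 fun t ht => ?_
  obtain ⟨x, hx⟩ := (inferInstance : (atTop : Filter ℝ).NeBot).nonempty_of_mem ht
  exact ⟨(x : ℂ), by simpa using hx⟩

lemma eventually_rightEnd_iff {p : ℂ → Prop} :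
    (∀ᶠ w in rightEnd, p w) ↔ ∃ r : ℝ, ∀ w : ℂ, r < w.re → p w := by
  rw [rightEnd, (atTop_basis_Ioi.comap Complex.re).eventually_iff]
  simp

lemma eventually_re_gt (r : ℝ) : ∀ᶠ w in rightEnd, r < w.re :=
  eventually_rightEnd_iff.2 ⟨r, fun _ h => h⟩

lemma tendsto_rightEnd_iff {F : ℂ → ℂ} :
    Tendsto F rightEnd rightEnd ↔ ∀ s : ℝ, ∀ᶠ w in rightEnd, s < (F w).re := by
  rw [rightEnd, tendsto_comap_iff, tendsto_atTop]
  refine ⟨fun h s => ?_, fun h s => (h s).mono fun _ => le_of_lt⟩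
  filter_upwards [h (s + 1)] with w hw
  simp only [Function.comp_apply] at hw
  linarith

lemma IsLift.tendsto {f : ℂ ≃ₜ ℂ} {F : ℂ → ℂ} {r : ℝ} (h : IsLift f F r) :
    Tendsto F rightEnd rightEnd := by
  refine tendsto_rightEnd_iff.2 fun s => ?_
  obtain ⟨t, -, ht⟩ := h.exists_re_gt s
  exact eventually_rightEnd_iff.2 ⟨t, ht⟩

/-- Near infinity, `F` is the chosen lift of `f` followed by the `k`-th power of the deck
translation. -/
def IsShiftedLift (F : ℂ → ℂ) (f : HomeoPlus) (k : ℤ) : Prop :=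
  ∀ᶠ w in rightEnd, F w = chosenLift f w + k * deck

lemma IsLift.exists_isShiftedLift {f : HomeoPlus} {F : ℂ → ℂ} {r : ℝ} (h : IsLift f F r) :
    ∃ k, IsShiftedLift F f k := by
  obtain ⟨s, hs⟩ := chosenLift_spec f
  have h1 := h.mono (le_max_left r s)
  have h2 := hs.mono (le_max_right r s)
  obtain ⟨k, hk⟩ := exists_int_of_exp_eq h1.continuousOn h2.continuousOn
    (fun w hw => by rw [h1.exp_eq w hw, h2.exp_eq w hw])
  exact ⟨k, eventually_rightEnd_iff.2 ⟨_, hk⟩⟩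

lemma IsShiftedLift.tendsto {F : ℂ → ℂ} {f : HomeoPlus} {k : ℤ} (h : IsShiftedLift F f k) :
    Tendsto F rightEnd rightEnd := by
  obtain ⟨s, hs⟩ := chosenLift_spec f
  refine tendsto_rightEnd_iff.2 fun t => ?_
  filter_upwards [h, tendsto_rightEnd_iff.1 hs.tendsto t] with w hw h2
  rwa [hw, Complex.add_re, int_deck_re, add_zero]

/-- Lifts commute with deck translations, so the shifts add; the factor set corrects for the chosen
lift of the product. -/
lemma IsShiftedLift.comp {F G : ℂ → ℂ} {f g : HomeoPlus} {k l : ℤ} (hF : IsShiftedLift F f k)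
    (hG : IsShiftedLift G g l) :
    IsShiftedLift (F ∘ G) (f * g) (k + l + factorSet (f, g)) := by
  obtain ⟨r, hr⟩ := chosenLift_spec f
  obtain ⟨s, hs⟩ := chosenLift_spec g
  filter_upwards [hG.tendsto.eventually hF, hG, tendsto_rightEnd_iff.1 hs.tendsto r,
    eventually_rightEnd_iff.2 (factorSet_spec f g)] with w h1 h2 h3 h4
  rw [Function.comp_apply, h1, h2, hr.map_add_int _ _ h3, h4]
  push_cast
  ring

lemma IsShiftedLift.eq_of_eventually {F G : ℂ → ℂ} {f : HomeoPlus} {k l m : ℤ}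
    (hF : IsShiftedLift F f k) (hG : IsShiftedLift G f l)
    (h : ∀ᶠ w in rightEnd, F w = G w + m * deck) : k = l + m := by
  obtain ⟨w, h1, h2, h3⟩ := (hF.and (hG.and h)).exists
  rw [h1, h2] at h3
  have h4 : (k : ℂ) * deck = ((l + m : ℤ) : ℂ) * deck := by
    push_cast
    linear_combination h3
  exact_mod_cast mul_right_cancel₀ deck_ne_zero h4

/-! ### The cycle of a product of commutators equal to one -/

section Cycle

variable {G : Type} [Group G]

/-- The product of the first `j` commutators `aᵢ bᵢ aᵢ⁻¹ bᵢ⁻¹`. -/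
def commProd (a b : ℕ → G) (j : ℕ) : G :=
  ((List.range j).map fun i => a i * b i * (a i)⁻¹ * (b i)⁻¹).prod

lemma commProd_zero (a b : ℕ → G) : commProd a b 0 = 1 := by simp [commProd]

lemma commProd_succ (a b : ℕ → G) (j : ℕ) :
    commProd a b (j + 1) = commProd a b j * (a j * b j * (a j)⁻¹ * (b j)⁻¹) := by
  simp [commProd, List.range_succ]

lemma map_commProd {H : Type} [Group H] (φ : G →* H) (a b : ℕ → G) (j : ℕ) :
    φ (commProd a b j) = commProd (φ ∘ a) (φ ∘ b) j := by
  induction j with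
  | zero => simp [commProd_zero]
  | succ j ih => simp [commProd_succ, ih]

/-- The chain of the bar complex carried by a surface of genus `g` whose standard generators
are sent to `aᵢ`, `bᵢ`. -/
def surfaceChain (a b : ℕ → G) (g : ℕ) : G × G →₀ ℤ :=
  ∑ i ∈ Finset.range g,
    (Finsupp.single (a i * b i * (a i)⁻¹ * (b i)⁻¹, b i * a i) 1 + Finsupp.single (b i, a i) 1
      - Finsupp.single (a i, b i) 1
      - Finsupp.single (commProd a b i, a i * b i * (a i)⁻¹ * (b i)⁻¹) 1)

lemma surfaceChain_mem (a b : ℕ → G) (g : ℕ) (h : commProd a b g = 1) :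
    surfaceChain a b g ∈ groupHomology.cycles₂ (Rep.trivial ℤ G ℤ) := by
  let d : (G × G →₀ ℤ) →ₗ[ℤ] (G →₀ ℤ) := (groupHomology.d₂₁ (Rep.trivial ℤ G ℤ)).hom
  have hd : ∀ x y : G, d (Finsupp.single (x, y) 1) =
      Finsupp.single y 1 - Finsupp.single (x * y) 1 + Finsupp.single x 1 :=
    fun x y => groupHomology.d₂₁_single (A := Rep.trivial ℤ G ℤ) (x, y) (1 : ℤ)
  -- With `c = [a, b]`, the first three simplices of a summand compare the two factorisations in `c
  -- · (ba) = ab` and have boundary `[c]`. The fourth appends `c` to the partial product, so the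
  -- boundaries telescope.
  have key : ∀ j, d (surfaceChain a b j) =
      Finsupp.single (commProd a b j) 1 - Finsupp.single 1 1 := by
    intro j
    induction j with
    | zero => simp [surfaceChain, commProd_zero]
    | succ j ih =>
      rw [surfaceChain, Finset.sum_range_succ, map_add, ← surfaceChain, ih, map_sub, map_sub,
        map_add, hd, hd, hd, hd, commProd_succ,
        show a j * b j * (a j)⁻¹ * (b j)⁻¹ * (b j * a j) = a j * b j by group]
      abel
  change d (surfaceChain a b g) = 0
  rw [key, h, sub_self]

lemma evalChain_surfaceChain (f : G × G → ℤ) (a b : ℕ → G) (g : ℕ) :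
    evalChain G f (surfaceChain a b g) =
      ∑ i ∈ Finset.range g, (f (a i * b i * (a i)⁻¹ * (b i)⁻¹, b i * a i) + f (b i, a i)
        - f (a i, b i) - f (commProd a b i, a i * b i * (a i)⁻¹ * (b i)⁻¹)) := by
  rw [surfaceChain, map_sum]
  refine Finset.sum_congr rfl fun i _ => ?_
  simp only [map_sub, map_add, evalChain_single, one_mul]

end Cycle

/-- If the commutators `[xᵢ, yᵢ]` are the identity near infinity and the commutators of lifts of
`xᵢ` and `yᵢ` are the translations by `Nᵢ · 2πi`, then the Euler cocycle takes the value `-∑ Nᵢ`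
on the cycle of `∏ [xᵢ, yᵢ] = 1`. -/
lemma sum_factorSet_eq (x y : ℕ → HomeoPlus) (X Y : ℕ → ℂ → ℂ) (N : ℕ → ℤ)
    (hX : ∀ i, ∃ r, IsLift (x i) (X i) r) (hY : ∀ i, ∃ r, IsLift (y i) (Y i) r)
    (hC : ∀ i, ∃ r, IsLift (x i * y i * (x i)⁻¹ * (y i)⁻¹ : HomeoPlus) id r)
    (hN : ∀ i, ∀ᶠ w in rightEnd, X i (Y i w) = Y i (X i w) + N i * deck)
    (g : ℕ) (hg : commProd x y g = 1) :
    ∑ i ∈ Finset.range g, (factorSet (x i * y i * (x i)⁻¹ * (y i)⁻¹, y i * x i)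
      + factorSet (y i, x i) - factorSet (x i, y i)
      - factorSet (commProd x y i, x i * y i * (x i)⁻¹ * (y i)⁻¹)) =
      -∑ i ∈ Finset.range g, N i := by
  choose r hr using hX
  choose s hs using hY
  choose t ht using hC
  choose k hk using fun i => (hr i).exists_isShiftedLift
  choose l hl using fun i => (hs i).exists_isShiftedLift
  choose m hm using fun i => (ht i).exists_isShiftedLift
  obtain ⟨e, he⟩ := (show IsLift (1 : HomeoPlus) id 0 from isLift_one).exists_isShiftedLift
  -- Each partial product is the identity near infinity, so `id` is one of its lifts; `q` is the
  -- shift of `id` relative to the chosen lift.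
  have key : ∀ j, ∃ q, IsShiftedLift id (commProd x y j) q ∧
      ∑ i ∈ Finset.range j, (factorSet (x i * y i * (x i)⁻¹ * (y i)⁻¹, y i * x i)
        + factorSet (y i, x i) - factorSet (x i, y i)
        - factorSet (commProd x y i, x i * y i * (x i)⁻¹ * (y i)⁻¹)) =
        e - q - ∑ i ∈ Finset.range j, N i := by
    intro j
    induction j with
    | zero => exact ⟨e, by simpa [commProd_zero] using he, by simp⟩
    | succ j ih =>
      obtain ⟨q, hq, hsum⟩ := ih
      have h1 := hq.comp (hm j)
      rw [← commProd_succ] at h1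
      -- Both `X ∘ Y` and `id ∘ (Y ∘ X)` lift `xy = [x, y] · yx`. Their shifts differ by `N j`.
      have h2 := (hm j).comp ((hl j).comp (hk j))
      rw [show x j * y j * (x j)⁻¹ * (y j)⁻¹ * (y j * x j) = x j * y j by group] at h2
      have h3 := ((hk j).comp (hl j)).eq_of_eventually h2 (hN j)
      refine ⟨_, h1, ?_⟩
      rw [Finset.sum_range_succ, hsum, Finset.sum_range_succ]
      linarith
  obtain ⟨q, hq, hsum⟩ := key g
  rw [hg] at hq
  have := hq.eq_of_eventually he (m := 0) (Eventually.of_forall fun w => by simp)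
  rw [hsum, this]
  ring

/-! ### Evaluation of the Euler class -/

lemma comp_factorSet_mem {G : Type} [Group G] (ρ : G →* HomeoPlus) :
    (fun p : G × G => factorSet (ρ p.1, ρ p.2)) ∈
      groupCohomology.cocycles₂ (Rep.trivial ℤ G ℤ) := by
  refine (groupCohomology.mem_cocycles₂_iff (A := Rep.trivial ℤ G ℤ) _).2 fun f g h => ?_
  have := (groupCohomology.mem_cocycles₂_iff (A := Rep.trivial ℤ HomeoPlus ℤ) factorSet).1
    factorSet_mem (ρ f) (ρ g) (ρ h)
  simpa using this

-- Naturality of the projection from cocycles to cohomology.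
open CategoryTheory in
lemma pullbackEulerClass_eq {G : Type} [Group G] (ρ : G →* HomeoPlus) :
    pullbackEulerClass ρ =
      groupCohomology.H2π (Rep.trivial ℤ G ℤ) ⟨_, comp_factorSet_mem ρ⟩ := by
  have h := groupCohomology.H2π_comp_map (A := Rep.trivial ℤ HomeoPlus ℤ) (B := Rep.trivial ℤ G ℤ) ρ
    (𝟙 (Rep.trivial ℤ G ℤ) : Rep.res ρ (Rep.trivial ℤ HomeoPlus ℤ) ⟶ Rep.trivial ℤ G ℤ)
  have h1 := ConcreteCategory.congr_hom h
    (⟨factorSet, factorSet_mem⟩ : groupCohomology.cocycles₂ (Rep.trivial ℤ HomeoPlus ℤ))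
  rw [ConcreteCategory.comp_apply, ConcreteCategory.comp_apply] at h1
  refine h1.trans ?_
  congr 1

lemma kronecker_pullbackEulerClass {G : Type} [Group G] (ρ : G →* HomeoPlus)
    (z : groupHomology.cycles₂ (Rep.trivial ℤ G ℤ)) :
    kronecker G (pullbackEulerClass ρ) (groupHomology.H2π (Rep.trivial ℤ G ℤ) z) =
      evalChain G (fun p => factorSet (ρ p.1, ρ p.2)) z.1 := by
  rw [pullbackEulerClass_eq]
  exact kronecker_apply G _ z

/-! ### Surface groups -/

/-- The `i`-th generator of the surface group, and `1` for `i ≥ g`. -/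
def surfaceGen (g : ℕ) (s : Fin g → Fin g ⊕ Fin g) (i : ℕ) : SurfaceGroup g :=
  if h : i < g then PresentedGroup.of (s ⟨i, h⟩) else 1

lemma lift_surfaceRelator {G : Type} [Group G] (x y : ℕ → G) (g : ℕ) :
    FreeGroup.lift (Sum.elim (fun i : Fin g => x i) (fun i : Fin g => y i)) (surfaceRelator g) =
      commProd x y g := by
  rw [surfaceRelator, map_list_prod, List.map_ofFn, commProd, List.ofFn_eq_map,
    ← List.map_coe_finRange_eq_range, List.map_map]
  congr 2
  funext i
  simp

lemma commProd_surfaceGen (g : ℕ) :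
    commProd (surfaceGen g Sum.inl) (surfaceGen g Sum.inr) g = 1 := by
  rw [← lift_surfaceRelator]
  have h : FreeGroup.lift (Sum.elim (fun i : Fin g => surfaceGen g Sum.inl i)
      (fun i : Fin g => surfaceGen g Sum.inr i)) =
      PresentedGroup.mk ({surfaceRelator g} : Set (FreeGroup (Fin g ⊕ Fin g))) := by
    ext j
    rcases j with j | j <;> simp [surfaceGen, PresentedGroup.of]
  rw [h]
  exact PresentedGroup.one_of_mem rfl

/-- The class in `H₂(π₁(S_g); ℤ)` of the standard cycle. -/
def standardClass (g : ℕ) : groupHomology.H2 (Rep.trivial ℤ (SurfaceGroup g) ℤ) :=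
  groupHomology.H2π (Rep.trivial ℤ (SurfaceGroup g) ℤ)
    ⟨surfaceChain (surfaceGen g Sum.inl) (surfaceGen g Sum.inr) g,
      surfaceChain_mem _ _ _ (commProd_surfaceGen g)⟩

lemma eulerNumber_standardClass {g : ℕ} (ρ : SurfaceGroup g →* HomeoPlus) :
    eulerNumber (standardClass g) ρ =
      ∑ i ∈ Finset.range g, (fun x y : ℕ → HomeoPlus =>
      (factorSet (x i * y i * (x i)⁻¹ * (y i)⁻¹, y i * x i)
      + factorSet (y i, x i) - factorSet (x i, y i)
      - factorSet (commProd x y i, x i * y i * (x i)⁻¹ * (y i)⁻¹)))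
        (ρ ∘ surfaceGen g Sum.inl) (ρ ∘ surfaceGen g Sum.inr) := by
  rw [eulerNumber, standardClass, kronecker_pullbackEulerClass, evalChain_surfaceChain]
  simp only [map_commProd, map_mul, map_inv, Function.comp_apply]


/-! ### Constructing elements of `Diff₊(ℝ²)` -/

/-- A smooth bijection of the plane with smooth inverse, as a homeomorphism. -/
@[simps apply]
def smoothHomeo (f g : ℂ → ℂ) (hf : ContDiff ℝ (⊤ : ℕ∞) f) (hg : ContDiff ℝ (⊤ : ℕ∞) g)
    (hgf : ∀ z, g (f z) = z) (hfg : ∀ z, f (g z) = z) : ℂ ≃ₜ ℂ where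
  toFun := f
  invFun := g
  left_inv := hgf
  right_inv := hfg
  continuous_toFun := hf.continuous
  continuous_invFun := hg.continuous

/-- The sign of the Jacobian of a diffeomorphism of the plane is constant. -/
lemma det_fderiv_pos {f : ℂ ≃ₜ ℂ} (hf : ContDiff ℝ (⊤ : ℕ∞) f)
    (hg : ContDiff ℝ (⊤ : ℕ∞) f.symm) (z₀ : ℂ) (h₀ : 0 < (fderiv ℝ f z₀).det) (z : ℂ) :
    0 < (fderiv ℝ f z).det := by
  have hne : ∀ z, (fderiv ℝ f z).det ≠ 0 := by
    intro z h
    have h1 : (fderiv ℝ f.symm (f z)).comp (fderiv ℝ f z) = ContinuousLinearMap.id ℝ ℂ := by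
      rw [← fderiv_comp z (hg.differentiable (by simp) _) (hf.differentiable (by simp) _)]
      have : (f.symm ∘ f : ℂ → ℂ) = id := by ext x; simp
      rw [this, fderiv_id]
    have h2 : ((fderiv ℝ f.symm (f z)).comp (fderiv ℝ f z)).det =
      (fderiv ℝ f.symm (f z)).det * (fderiv ℝ f z).det := LinearMap.det_comp _ _
    rw [h1, h, mul_zero] at h2
    simp [ContinuousLinearMap.det] at h2
  have hc : Continuous fun z => (fderiv ℝ f z).det :=
    ContinuousLinearMap.continuous_det.comp (hf.continuous_fderiv (by simp))
  -- The Jacobian is continuous on a connected space and never zero, so it cannot change sign.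
  by_contra! hz
  obtain ⟨w, hw⟩ := mem_range_of_exists_le_of_exists_ge hc ⟨z, hz⟩ ⟨z₀, h₀.le⟩
  exact hne w hw

lemma mem_diffPlus_of_det {f : ℂ ≃ₜ ℂ} (hf : ContDiff ℝ (⊤ : ℕ∞) f)
    (hg : ContDiff ℝ (⊤ : ℕ∞) f.symm) {F : ℂ → ℂ} {r : ℝ} (hF : IsLift f F r) (z₀ : ℂ)
    (h₀ : 0 < (fderiv ℝ f z₀).det) : f ∈ DiffPlus :=
  ⟨⟨F, r, hF⟩, hf, hg, det_fderiv_pos hf hg z₀ h₀⟩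

lemma det_fderiv_pos_of_eventually_eq_add {f : ℂ → ℂ} {z₀ c : ℂ} (h : ∀ᶠ z in 𝓝 z₀, f z = z + c) :
    0 < (fderiv ℝ f z₀).det := by
  have h1 : f =ᶠ[𝓝 z₀] fun z => z + c := h
  rw [h1.fderiv_eq, fderiv_add_const, fderiv_fun_id]
  simp [ContinuousLinearMap.det]

/-! ### Dilations and twists -/

/-- The dilation of the plane with factor `√e`. -/
def dilation : ℂ ≃ₜ ℂ :=
  smoothHomeo (fun z => Complex.exp (1 / 2) * z) (fun z => Complex.exp (-(1 / 2)) * z)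
    (contDiff_const.mul contDiff_id) (contDiff_const.mul contDiff_id)
    (fun z => by rw [← mul_assoc, ← Complex.exp_add]; simp)
    (fun z => by rw [← mul_assoc, ← Complex.exp_add]; simp)

lemma isLift_dilation : IsLift dilation (fun w => w + 1 / 2) 0 := by
  refine ⟨by fun_prop, fun w _ => ?_, fun w _ => by ring⟩
  rw [Complex.exp_add, mul_comm]
  rfl

lemma dilation_mem : dilation ∈ DiffPlus := by
  refine mem_diffPlus_of_det (contDiff_const.mul contDiff_id) (contDiff_const.mul contDiff_id)
    isLift_dilation 0 ?_
  have h : (dilation : ℂ → ℂ) = fun z => Real.exp (1 / 2) • z := by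
    funext z
    simp [dilation]
  rw [h, fderiv_fun_const_smul differentiableAt_fun_id, fderiv_fun_id]
  simp only [ContinuousLinearMap.det, ContinuousLinearMap.toLinearMap_smul, LinearMap.det_smul]
  simp
  positivity

/-- The map rotating the circle `|z|² = u` by the angle `θ(u)`. -/
def twist (θ : ℝ → ℝ) (z : ℂ) : ℂ := z * Complex.exp (θ (Complex.normSq z) * Complex.I)

lemma norm_twist (θ : ℝ → ℝ) (z : ℂ) : ‖twist θ z‖ = ‖z‖ := by
  rw [twist, norm_mul, Complex.norm_exp_ofReal_mul_I, mul_one]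

lemma twist_twist (θ η : ℝ → ℝ) (z : ℂ) : twist θ (twist η z) = twist (θ + η) z := by
  have h : Complex.normSq (twist η z) = Complex.normSq z := by
    rw [Complex.normSq_eq_norm_sq, norm_twist, Complex.normSq_eq_norm_sq]
  rw [twist, h, twist, twist, mul_assoc, ← Complex.exp_add, Pi.add_apply]
  push_cast
  ring_nf

lemma twist_zero (z : ℂ) : twist 0 z = z := by simp [twist]

/-- The angle depends on `|z|²` rather than `|z|`, so smoothness holds at the origin too. -/
lemma contDiff_twist {θ : ℝ → ℝ} (hθ : ContDiff ℝ (⊤ : ℕ∞) θ) :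
    ContDiff ℝ (⊤ : ℕ∞) (twist θ) := by
  have h1 : ContDiff ℝ (⊤ : ℕ∞) Complex.normSq := by
    have : (Complex.normSq : ℂ → ℝ) = fun z => ‖z‖ ^ 2 :=
      funext fun z => Complex.normSq_eq_norm_sq z
    rw [this]
    exact contDiff_norm_sq ℝ
  have h2 : ContDiff ℝ (⊤ : ℕ∞) fun z : ℂ => ((θ (Complex.normSq z) : ℝ) : ℂ) :=
    Complex.ofRealCLM.contDiff.comp (hθ.comp h1)
  exact contDiff_id.mul (h2.mul contDiff_const).cexp

/-- The twist with angle function `θ` as a homeomorphism. -/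
def twistHomeo (θ : ℝ → ℝ) (hθ : ContDiff ℝ (⊤ : ℕ∞) θ) : ℂ ≃ₜ ℂ :=
  smoothHomeo (twist θ) (twist (-θ)) (contDiff_twist hθ) (contDiff_twist hθ.neg)
    (fun z => by rw [twist_twist, neg_add_cancel, twist_zero])
    (fun z => by rw [twist_twist, add_neg_cancel, twist_zero])

lemma isLift_twistHomeo (θ : ℝ → ℝ) (hθ : ContDiff ℝ (⊤ : ℕ∞) θ) :
    IsLift (twistHomeo θ hθ) (fun w => w + θ (Real.exp (2 * w.re)) * Complex.I) 0 := by
  have hc := hθ.continuous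
  refine ⟨by fun_prop, fun w _ => ?_, fun w _ => ?_⟩
  · have h : Complex.normSq (Complex.exp w) = Real.exp (2 * w.re) := by
      rw [Complex.normSq_eq_norm_sq, Complex.norm_exp, ← Real.exp_nat_mul]
      norm_num
    change _ = twist θ (Complex.exp w)
    rw [Complex.exp_add, twist, h]
  · rw [Complex.add_re, deck_re, add_zero]
    ring

lemma twistHomeo_mem (θ : ℝ → ℝ) (hθ : ContDiff ℝ (⊤ : ℕ∞) θ) (h0 : ∀ u ≤ 1, θ u = 0) :
    twistHomeo θ hθ ∈ DiffPlus := by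
  refine mem_diffPlus_of_det (contDiff_twist hθ) (contDiff_twist hθ.neg) (isLift_twistHomeo θ hθ) 0
    (det_fderiv_pos_of_eventually_eq_add (c := 0) ?_)
  filter_upwards [Metric.ball_mem_nhds (0 : ℂ) one_pos] with z hz
  change twist θ z = _
  have : Complex.normSq z ≤ 1 := by
    rw [Complex.normSq_eq_norm_sq]
    rw [mem_ball_zero_iff] at hz
    nlinarith [norm_nonneg z]
  simp [twist, h0 _ this]

/-! ### Bounded homeomorphisms -/

/-- The lift with displacement tending to zero of a map at bounded distance from the identity. -/
def smallLift (f : ℂ → ℂ) (w : ℂ) : ℂ := w + Complex.log (f (Complex.exp w) / Complex.exp w)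

lemma norm_div_exp_sub_one_le {f : ℂ → ℂ} {C : ℝ} (hf : ∀ z, ‖f z - z‖ ≤ C) (w : ℂ) :
    ‖f (Complex.exp w) / Complex.exp w - 1‖ ≤ C * Real.exp (-w.re) := by
  have h := Complex.exp_ne_zero w
  rw [div_sub_one h, norm_div, Complex.norm_exp, Real.exp_neg, ← div_eq_mul_inv]
  gcongr
  exact hf _

/-- For `Re w > C` the quotient `f(eʷ)/eʷ` is within distance less than `1` of `1`, because `C < Re
w < exp (Re w)`. It thus stays where the principal logarithm is continuous. -/
lemma isLift_smallLift (f : ℂ ≃ₜ ℂ) {C : ℝ} (hf : ∀ z, ‖f z - z‖ ≤ C) :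
    IsLift f (smallLift f) C := by
  have hslit : ∀ w : ℂ, C < w.re → f (Complex.exp w) / Complex.exp w ∈ Complex.slitPlane := by
    intro w hw
    have h1 := norm_div_exp_sub_one_le hf w
    have h2 : C * Real.exp (-w.re) < 1 := by
      rw [Real.exp_neg, ← div_eq_mul_inv, div_lt_one (Real.exp_pos _)]
      linarith [Real.add_one_le_exp w.re]
    have h3 := (Complex.abs_re_le_norm _).trans_lt (h1.trans_lt h2)
    rw [Complex.sub_re, Complex.one_re, abs_lt] at h3
    exact Or.inl (by linarith [h3.1])
  refine ⟨?_, fun w hw => ?_, fun w _ => ?_⟩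
  · refine continuousOn_id.add (ContinuousOn.clog ?_ hslit)
    refine Continuous.continuousOn (Continuous.div ?_ Complex.continuous_exp Complex.exp_ne_zero)
    exact f.continuous.comp Complex.continuous_exp
  · rw [smallLift, Complex.exp_add, Complex.exp_log (Complex.slitPlane_ne_zero (hslit w hw)),
      mul_div_cancel₀ _ (Complex.exp_ne_zero _)]
  · have h := exp_add_int_deck w 1
    rw [Int.cast_one, one_mul] at h
    rw [smallLift, smallLift, h]
    ring

lemma tendsto_smallLift_sub {f : ℂ → ℂ} {C : ℝ} (hf : ∀ z, ‖f z - z‖ ≤ C) :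
    Tendsto (fun w => smallLift f w - w) rightEnd (𝓝 0) := by
  have h1 : Tendsto (fun w : ℂ => C * Real.exp (-w.re)) rightEnd (𝓝 0) := by
    have := (Real.tendsto_exp_neg_atTop_nhds_zero.comp
      (tendsto_comap (f := Complex.re) (x := atTop))).const_mul C
    simpa [rightEnd, Function.comp_def] using this
  have h2 : Tendsto (fun w => f (Complex.exp w) / Complex.exp w) rightEnd (𝓝 1) := by
    rw [tendsto_iff_norm_sub_tendsto_zero]
    exact squeeze_zero (fun _ => norm_nonneg _) (norm_div_exp_sub_one_le hf) h1
  have h3 := h2.clog Complex.one_mem_slitPlane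
  rw [Complex.log_one] at h3
  simpa [smallLift] using h3

/-- The small lifts of two bounded homeomorphisms commute near infinity as soon as the
homeomorphisms do. -/
lemma smallLift_commute (f g : ℂ ≃ₜ ℂ) {C D : ℝ} (hf : ∀ z, ‖f z - z‖ ≤ C)
    (hg : ∀ z, ‖g z - z‖ ≤ D)
    (h : ∀ᶠ w in rightEnd, f (g (Complex.exp w)) = g (f (Complex.exp w))) :
    ∀ᶠ w in rightEnd, smallLift f (smallLift g w) = smallLift g (smallLift f w) := by
  have hF := isLift_smallLift f hf
  have hG := isLift_smallLift g hg
  have t1 := (tendsto_smallLift_sub hf).comp hG.tendsto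
  have t2 := (tendsto_smallLift_sub hg).comp hF.tendsto
  have t := ((t1.add (tendsto_smallLift_sub hg)).sub
    (t2.add (tendsto_smallLift_sub hf))).norm
  -- All displacements tend to zero, so the two composites become arbitrarily close. They differ by
  -- an element of `2πiℤ`, which vanishes once its norm is below `1`.
  have ht : ∀ᶠ w in rightEnd,
      ‖smallLift f (smallLift g w) - smallLift g (smallLift f w)‖ < 1 := by
    have h01 : ‖(0 + 0 - (0 + 0) : ℂ)‖ < 1 := by simp
    filter_upwards [t.eventually (gt_mem_nhds h01)] with w hw
    simp only [Function.comp_apply] at hw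
    refine lt_of_eq_of_lt (congrArg norm ?_) hw
    ring
  filter_upwards [ht, h, eventually_re_gt C, eventually_re_gt D,
    tendsto_rightEnd_iff.1 hG.tendsto C, tendsto_rightEnd_iff.1 hF.tendsto D]
    with w hw hfg h1 h2 h3 h4
  have he : Complex.exp (smallLift f (smallLift g w)) =
      Complex.exp (smallLift g (smallLift f w)) := by
    rw [hF.exp_eq _ h3, hG.exp_eq _ h4, hF.exp_eq _ h1, hG.exp_eq _ h2, hfg]
  obtain ⟨k, hk⟩ := Complex.exp_eq_exp_iff_exists_int.1 he
  rw [hk, add_sub_cancel_left] at hw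
  have h6 : ‖(k : ℂ) * (2 * Real.pi * Complex.I)‖ = |(k : ℝ)| * (2 * Real.pi) := by
    simp [abs_of_pos Real.pi_pos]
  rw [h6] at hw
  have h7 : |(k : ℝ)| < 1 := by
    have := Real.two_le_pi
    nlinarith [abs_nonneg (k : ℝ)]
  have h8 : k = 0 := Int.abs_lt_one_iff.1 (by exact_mod_cast h7)
  rw [hk, h8]
  simp

/-! ### Spreading a compactly supported map along a half line -/

/-- A norm preserving map supported in the disc of radius `3`. -/
structure IsDiscMap (e : ℂ → ℂ) : Prop where
  norm_eq : ∀ z, ‖e z‖ = ‖z‖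
  eq_self : ∀ z, 3 ≤ ‖z‖ → e z = z

/-- The disc of radius `3` is mapped to itself and the rest is fixed. Hence vertical strips
containing the disc are preserved, and `spread` can be studied one strip at a time. -/
lemma IsDiscMap.abs_re_le {e : ℂ → ℂ} (he : IsDiscMap e) {z : ℂ} {c : ℝ} (hc : 3 ≤ c)
    (hz : |z.re| ≤ c) : |(e z).re| ≤ c := by
  rcases le_or_gt 3 ‖z‖ with h | h
  · rwa [he.eq_self z h]
  · exact (Complex.abs_re_le_norm _).trans (by rw [he.norm_eq]; linarith)

lemma IsDiscMap.eq_self_of_abs_re {e : ℂ → ℂ} (he : IsDiscMap e) {z : ℂ} (hz : 3 ≤ |z.re|) :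
    e z = z :=
  he.eq_self z (hz.trans (Complex.abs_re_le_norm z))

/-- The infinite product of the conjugates of `e` by the translations by `8k`, `k ≥ 0`. -/
def spread (e : ℂ → ℂ) (z : ℂ) : ℂ :=
  if 0 ≤ round (z.re / 8) then e (z - 8 * round (z.re / 8)) + 8 * round (z.re / 8) else z

lemma abs_sub_round_le (x : ℝ) : |x - 8 * round (x / 8)| ≤ 4 := by
  have := abs_sub_round (x / 8)
  rw [abs_le] at this ⊢
  constructor <;> linarith [this.1, this.2]

lemma round_eq_of_abs_lt {x : ℝ} {k : ℤ} (h : |x - 8 * k| < 4) : round (x / 8) = k := by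
  rw [abs_lt] at h
  rw [round_eq, Int.floor_eq_iff]
  constructor <;> linarith [h.1, h.2]

lemma re_sub_int (z : ℂ) (k : ℤ) : (z - 8 * k).re = z.re - 8 * k := by simp

lemma spread_of_nonneg {e : ℂ → ℂ} {k : ℤ} (hk : 0 ≤ k) {z : ℂ} (hz : |z.re - 8 * k| < 4) :
    spread e z = e (z - 8 * k) + 8 * k := by
  rw [spread, round_eq_of_abs_lt hz, if_pos hk]

lemma spread_of_neg (e : ℂ → ℂ) {k : ℤ} (hk : k < 0) {z : ℂ} (hz : |z.re - 8 * k| < 4) :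
    spread e z = z := by
  rw [spread, round_eq_of_abs_lt hz, if_neg (not_le.2 hk)]

lemma IsDiscMap.spread_eq_self {e : ℂ → ℂ} (he : IsDiscMap e) {z : ℂ}
    (hz : 3 ≤ |z.re - 8 * round (z.re / 8)|) : spread e z = z := by
  rw [spread]
  split_ifs with h
  · rw [he.eq_self_of_abs_re (by rwa [re_sub_int])]
    ring
  · rfl

lemma spread_spread {e e' : ℂ → ℂ} (he : IsDiscMap e) (he' : IsDiscMap e')
    (h : ∀ z, e (e' z) = z) (z : ℂ) : spread e (spread e' z) = z := by
  rcases le_or_gt 3 |z.re - 8 * round (z.re / 8)| with h3 | h3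
  · rw [he'.spread_eq_self h3, he.spread_eq_self h3]
  · have h4 : |z.re - 8 * round (z.re / 8)| < 4 := by linarith
    rcases le_or_gt 0 (round (z.re / 8)) with hk | hk
    · rw [spread_of_nonneg hk h4, spread_of_nonneg hk, add_sub_cancel_right, h, sub_add_cancel]
      have := he'.abs_re_le le_rfl (z := z - 8 * round (z.re / 8)) (by rw [re_sub_int]; exact h3.le)
      rw [← re_sub_int, add_sub_cancel_right]
      linarith
    · rw [spread_of_neg e' hk h4, spread_of_neg e hk h4]

lemma contDiff_spread {e : ℂ → ℂ} (he : IsDiscMap e) (hs : ContDiff ℝ (⊤ : ℕ∞) e) :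
    ContDiff ℝ (⊤ : ℕ∞) (spread e) := by
  refine contDiff_iff_contDiffAt.2 fun z => ?_
  have hcont : ∀ k : ℤ, Continuous fun z : ℂ => |z.re - 8 * k| := fun k =>
    (Complex.continuous_re.sub continuous_const).abs
  set k := round (z.re / 8) with hk
  rcases le_or_gt |z.re - 8 * k| 3 with h | h
  · have hnear : ∀ᶠ y : ℂ in 𝓝 z, |y.re - 8 * k| < 4 :=
      (hcont k).continuousAt.eventually (gt_mem_nhds (h.trans_lt (by norm_num)))
    rcases le_or_gt 0 k with h0 | h0
    · have h1 : ContDiffAt ℝ (⊤ : ℕ∞) (fun y => e (y - 8 * k) + 8 * k) z :=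
        ((hs.comp (contDiff_id.sub contDiff_const)).add contDiff_const).contDiffAt
      exact h1.congr_of_eventuallyEq (hnear.mono fun y hy => spread_of_nonneg h0 hy)
    · exact contDiffAt_id.congr_of_eventuallyEq (hnear.mono fun y hy => spread_of_neg e h0 hy)
  · have hfar : ∀ᶠ y : ℂ in 𝓝 z, 3 < |y.re - 8 * k| :=
      (hcont k).continuousAt.eventually (lt_mem_nhds h)
    -- Consecutive centres are `8` apart: a point within `5` of the line `Re = 8k` is at least `3`
    -- from every other line `Re = 8m`, hence outside the other discs.
    have hfar' : ∀ᶠ y : ℂ in 𝓝 z, |y.re - 8 * k| < 5 :=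
      (hcont k).continuousAt.eventually
        (gt_mem_nhds (lt_of_le_of_lt (abs_sub_round_le z.re) (by norm_num)))
    refine contDiffAt_id.congr_of_eventuallyEq ?_
    filter_upwards [hfar, hfar'] with y h1 h2
    refine he.spread_eq_self ?_
    set m := round (y.re / 8)
    by_cases hm : m = k
    · rw [hm]; exact h1.le
    · have h3 : (1 : ℝ) ≤ |(m : ℝ) - k| := by
        exact_mod_cast Int.one_le_abs (sub_ne_zero.2 hm)
      have h4 : |8 * (m : ℝ) - 8 * k| ≤ |y.re - 8 * k| + |y.re - 8 * m| := by
        rw [abs_sub_comm y.re (8 * m)]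
        calc _ = |(y.re - 8 * k) + (8 * m - y.re)| := by ring_nf
          _ ≤ _ := abs_add_le _ _
      rw [← mul_sub, abs_mul, abs_of_pos (by norm_num : (0 : ℝ) < 8)] at h4
      linarith

/-- Each disc of radius `3` is preserved, so no point moves by more than its diameter. -/
lemma norm_spread_sub_le {e : ℂ → ℂ} (he : IsDiscMap e) (z : ℂ) : ‖spread e z - z‖ ≤ 6 := by
  rw [spread]
  split_ifs with h
  · set v := z - 8 * round (z.re / 8) with hv
    rw [show e v + 8 * round (z.re / 8) - z = e v - v by rw [hv]; ring]
    rcases le_or_gt 3 ‖v‖ with h3 | h3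
    · rw [he.eq_self v h3]; simp
    · calc ‖e v - v‖ ≤ ‖e v‖ + ‖v‖ := norm_sub_le _ _
        _ ≤ 6 := by rw [he.norm_eq]; linarith
  · simp

/-- The infinite product `∏_{k ≥ 0} sᵏ e s⁻ᵏ`, where `s` is the translation by `8`, absorbs `e`. -/
lemma spread_add_eight {e : ℂ → ℂ} (he : IsDiscMap e) (z : ℂ) :
    spread e (z + 8) = e (spread e z + 8) := by
  have hr : round ((z + 8).re / 8) = round (z.re / 8) + 1 := by
    rw [Complex.add_re, show ((8 : ℂ)).re = 8 by simp, add_div, div_self (by norm_num),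
      round_add_one]
  have ha := abs_sub_round_le z.re
  rw [spread, spread, hr]
  set m := round (z.re / 8)
  -- Left of the strip `m = -1` nothing moves. For `m = -1` the shifted point enters the strip of
  -- index `0`, where the outer `e` is the new factor. For `m ≥ 0` the shifted point has real part
  -- at least `4`, where the outer `e` is trivial.
  rcases lt_trichotomy m (-1) with h | h | h
  · rw [if_neg (by omega), if_neg (by omega), he.eq_self_of_abs_re]
    have h1 : (m : ℝ) ≤ -2 := by exact_mod_cast (by omega : m ≤ -2)
    rw [abs_le] at ha
    rw [Complex.add_re, show ((8 : ℂ)).re = 8 by simp, abs_of_nonpos] <;> linarith [ha.2]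
  · rw [h, if_pos (by norm_num), if_neg (by norm_num)]
    simp
  · have h1 : (0 : ℝ) ≤ m := by exact_mod_cast (by omega : 0 ≤ m)
    rw [if_pos (by omega), if_pos (by omega), he.eq_self_of_abs_re (z := _ + _ + 8)]
    · push_cast
      ring_nf
    · have h2 := he.abs_re_le (c := 4) (by norm_num) (z := z - 8 * m) (by rwa [re_sub_int])
      rw [abs_le] at h2
      have h3 : (e (z - 8 * m) + 8 * m + 8).re = (e (z - 8 * m)).re + 8 * m + 8 := by simp
      rw [h3, abs_of_nonneg] <;> linarith [h2.1]

/-- The spread of a compactly supported diffeomorphism. -/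
def spreadHomeo (e e' : ℂ → ℂ) (he : IsDiscMap e) (he' : IsDiscMap e')
    (hs : ContDiff ℝ (⊤ : ℕ∞) e) (hs' : ContDiff ℝ (⊤ : ℕ∞) e')
    (h : ∀ z, e' (e z) = z) (h' : ∀ z, e (e' z) = z) : ℂ ≃ₜ ℂ :=
  smoothHomeo (spread e) (spread e') (contDiff_spread he hs) (contDiff_spread he' hs')
    (spread_spread he' he h) (spread_spread he he' h')

lemma spreadHomeo_mem {e e' : ℂ → ℂ} (he : IsDiscMap e) (he' : IsDiscMap e')
    (hs : ContDiff ℝ (⊤ : ℕ∞) e) (hs' : ContDiff ℝ (⊤ : ℕ∞) e')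
    (h : ∀ z, e' (e z) = z) (h' : ∀ z, e (e' z) = z) :
    spreadHomeo e e' he he' hs hs' h h' ∈ DiffPlus := by
  -- The point `-8` is the centre of the strip of index `-1`, on which the spread is the identity.
  refine mem_diffPlus_of_det (contDiff_spread he hs) (contDiff_spread he' hs')
    (isLift_smallLift _ (norm_spread_sub_le he)) (-8)
    (det_fderiv_pos_of_eventually_eq_add (c := 0) ?_)
  have hc : Continuous fun z : ℂ => |z.re - 8 * ((-1 : ℤ) : ℝ)| :=
    (Complex.continuous_re.sub continuous_const).abs
  have hlt : |(-8 : ℂ).re - 8 * ((-1 : ℤ) : ℝ)| < 4 := by norm_num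
  filter_upwards [hc.continuousAt.eventually (gt_mem_nhds hlt)] with z hz
  rw [add_zero]
  exact spread_of_neg e (by norm_num) hz

/-- The translation of the plane by `8`. -/
def translation : ℂ ≃ₜ ℂ :=
  smoothHomeo (fun z => z + 8) (fun z => z - 8) (contDiff_id.add contDiff_const)
    (contDiff_id.sub contDiff_const) (fun z => by ring) (fun z => by ring)

lemma norm_translation_sub_le (z : ℂ) : ‖translation z - z‖ ≤ 8 := by simp [translation]

lemma translation_mem : translation ∈ DiffPlus :=
  mem_diffPlus_of_det (contDiff_id.add contDiff_const) (contDiff_id.sub contDiff_const)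
    (isLift_smallLift _ norm_translation_sub_le) 0
    (det_fderiv_pos_of_eventually_eq_add (c := 8) (Eventually.of_forall fun _ => rfl))

/-! ### The spiral twist -/

/-- An angle function vanishing for `u ≤ 1` and equal to `-2πN log u` for `u ≥ 2`. -/
def spiralAngle (N : ℤ) (u : ℝ) : ℝ :=
  -(2 * Real.pi * N) * (Real.smoothTransition (u - 1) * Real.log u)

lemma spiralAngle_of_le_one (N : ℤ) {u : ℝ} (hu : u ≤ 1) : spiralAngle N u = 0 := by
  rw [spiralAngle, Real.smoothTransition.zero_of_nonpos (by linarith)]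
  ring

lemma spiralAngle_of_two_le (N : ℤ) {u : ℝ} (hu : 2 ≤ u) :
    spiralAngle N u = -(2 * Real.pi * N) * Real.log u := by
  rw [spiralAngle, Real.smoothTransition.one_of_one_le (by linarith), one_mul]

/-- The singularity of the logarithm at `0` lies where the cutoff makes the function vanish. -/
lemma contDiff_spiralAngle (N : ℤ) : ContDiff ℝ (⊤ : ℕ∞) (spiralAngle N) := by
  refine contDiff_iff_contDiffAt.2 fun u => ?_
  rcases lt_or_ge u 1 with h | h
  · refine (contDiffAt_const (c := (0 : ℝ))).congr_of_eventuallyEq ?_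
    filter_upwards [gt_mem_nhds h] with v hv
    exact spiralAngle_of_le_one N hv.le
  · have h1 : ContDiffAt ℝ (⊤ : ℕ∞) (fun u : ℝ => Real.smoothTransition (u - 1)) u :=
      (Real.smoothTransition.contDiff.comp (contDiff_id.sub contDiff_const)).contDiffAt
    exact contDiffAt_const.mul (h1.mul (Real.contDiffAt_log.2 (by linarith)))

/-- The angle function of the commutator of the dilation and the spiral twist. -/
def ringAngle (N : ℤ) (u : ℝ) : ℝ := spiralAngle N (u * Real.exp (-1)) - spiralAngle N u

lemma contDiff_ringAngle (N : ℤ) : ContDiff ℝ (⊤ : ℕ∞) (ringAngle N) :=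
  ((contDiff_spiralAngle N).comp (contDiff_id.mul contDiff_const)).sub (contDiff_spiralAngle N)

/-- Once `u/e ≥ 2`, both angles are logarithmic and `log (u/e) = log u - 1`. The bound `9 = 3²`
suffices since `2e < 9`, and it matches the radius in `IsDiscMap`. -/
lemma ringAngle_of_nine_le (N : ℤ) {u : ℝ} (hu : 9 ≤ u) : ringAngle N u = N * (2 * Real.pi) := by
  have h1 : 2 ≤ u * Real.exp (-1) := by
    rw [Real.exp_neg, ← div_eq_mul_inv, le_div_iff₀ (Real.exp_pos _)]
    linarith [Real.exp_one_lt_d9]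
  rw [ringAngle, spiralAngle_of_two_le N h1, spiralAngle_of_two_le N (by linarith),
    Real.log_mul (by linarith) (Real.exp_ne_zero _), Real.log_exp]
  ring

lemma isDiscMap_twist {θ : ℝ → ℝ} (k : ℤ) (h : ∀ u, 9 ≤ u → θ u = k * (2 * Real.pi)) :
    IsDiscMap (twist θ) := by
  refine ⟨norm_twist θ, fun z hz => ?_⟩
  have h1 : 9 ≤ Complex.normSq z := by
    rw [Complex.normSq_eq_norm_sq]
    nlinarith
  rw [twist, h _ h1]
  push_cast
  rw [mul_assoc, Complex.exp_int_mul_two_pi_mul_I, mul_one]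


/-- The diffeomorphism supported in an annulus that is the commutator of the dilation and the
spiral twist. -/
def ringTwist (N : ℤ) : ℂ ≃ₜ ℂ := twistHomeo (ringAngle N) (contDiff_ringAngle N)

lemma isDiscMap_ringTwist (N : ℤ) : IsDiscMap (ringTwist N) :=
  isDiscMap_twist N fun _ => ringAngle_of_nine_le N

lemma isDiscMap_ringTwist_symm (N : ℤ) : IsDiscMap (ringTwist N).symm :=
  isDiscMap_twist (-N) fun u hu => by
    rw [Pi.neg_apply, ringAngle_of_nine_le N hu]
    push_cast
    ring

/-- The spiral twist of the plane. -/
def spiral (N : ℤ) : ℂ ≃ₜ ℂ := twistHomeo (spiralAngle N) (contDiff_spiralAngle N)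

/-- The spread of the ring twist. -/
def spreadRing (N : ℤ) : ℂ ≃ₜ ℂ :=
  spreadHomeo (ringTwist N) (ringTwist N).symm (isDiscMap_ringTwist N) (isDiscMap_ringTwist_symm N)
    (contDiff_twist (contDiff_ringAngle N)) (contDiff_twist (contDiff_ringAngle N).neg)
    (ringTwist N).symm_apply_apply (ringTwist N).apply_symm_apply

/-- Conjugating by the dilation, which multiplies `|z|²` by `e`, turns the angle function `θ(u)`
into `θ(u/e)`. -/
lemma dilation_mul_spiral (N : ℤ) : dilation * spiral N = ringTwist N * (spiral N * dilation) := by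
  ext z
  change Complex.exp (1 / 2) * twist (spiralAngle N) z =
    twist (ringAngle N) (twist (spiralAngle N) (Complex.exp (1 / 2) * z))
  have h : Complex.normSq (Complex.exp (1 / 2) * z) = Complex.normSq z * Real.exp 1 := by
    rw [Complex.normSq_mul, Complex.normSq_eq_norm_sq (Complex.exp _), Complex.norm_exp,
      ← Real.exp_nat_mul]
    norm_num [mul_comm]
  rw [twist_twist, twist, twist, h, Pi.add_apply, ringAngle, sub_add_cancel,
    mul_assoc (Complex.normSq z), ← Real.exp_add]
  simp [mul_assoc]

lemma spreadRing_mul_translation (N : ℤ) :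
    spreadRing N * translation = ringTwist N * (translation * spreadRing N) := by
  ext z
  exact spread_add_eight (isDiscMap_ringTwist N) z

/-! ### The action of the surface group and its Euler number -/

/-- The images of the generators `aᵢ`. -/
def actionA (i : ℕ) : DiffPlus :=
  match i with
  | 0 => ⟨dilation, dilation_mem⟩
  | 1 => ⟨translation, translation_mem⟩
  | _ => 1

/-- The images of the generators `bᵢ`. -/
def actionB (N : ℤ) (i : ℕ) : DiffPlus :=
  match i with
  | 0 => ⟨spiral N, twistHomeo_mem _ _ fun _ => spiralAngle_of_le_one N⟩
  | 1 => ⟨spreadRing N, spreadHomeo_mem _ _ _ _ _ _⟩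
  | _ => 1

lemma comm_zero (N : ℤ) :
    ((actionA 0 * actionB N 0 * (actionA 0)⁻¹ * (actionB N 0)⁻¹ : DiffPlus) : ℂ ≃ₜ ℂ) =
      ringTwist N := by
  change dilation * spiral N * dilation⁻¹ * (spiral N)⁻¹ = ringTwist N
  rw [dilation_mul_spiral]
  group

lemma comm_one (N : ℤ) :
    ((actionA 1 * actionB N 1 * (actionA 1)⁻¹ * (actionB N 1)⁻¹ : DiffPlus) : ℂ ≃ₜ ℂ) =
      (ringTwist N)⁻¹ := by
  change translation * spreadRing N * translation⁻¹ * (spreadRing N)⁻¹ = (ringTwist N)⁻¹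
  rw [mul_assoc, ← mul_inv_rev, spreadRing_mul_translation]
  group

lemma commProd_action (N : ℤ) (j : ℕ) : commProd actionA (actionB N) (j + 2) = 1 := by
  induction j with
  | zero =>
    refine Subtype.ext ?_
    rw [commProd_succ, commProd_succ, commProd_zero, one_mul, Subgroup.coe_mul, comm_zero,
      comm_one, mul_inv_cancel, Subgroup.coe_one]
  | succ j ih =>
    rw [commProd_succ, ih]
    simp [actionA, actionB]

/-- The lifts of the images of the generators `aᵢ`. -/
def liftA (i : ℕ) : ℂ → ℂ :=
  match i with
  | 0 => fun w => w + 1 / 2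
  | 1 => smallLift translation
  | _ => id

/-- The lifts of the images of the generators `bᵢ`. -/
def liftB (N : ℤ) (i : ℕ) : ℂ → ℂ :=
  match i with
  | 0 => fun w => w + spiralAngle N (Real.exp (2 * w.re)) * Complex.I
  | 1 => smallLift (spreadRing N)
  | _ => id

lemma norm_spreadRing_sub_le (N : ℤ) (z : ℂ) : ‖spreadRing N z - z‖ ≤ 6 :=
  norm_spread_sub_le (isDiscMap_ringTwist N) z

lemma isLift_liftA (i : ℕ) : ∃ r, IsLift (actionA i) (liftA i) r :=
  match i with
  | 0 => ⟨_, isLift_dilation⟩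
  | 1 => ⟨_, isLift_smallLift translation norm_translation_sub_le⟩
  | _ + 2 => ⟨_, isLift_one⟩

lemma isLift_liftB (N : ℤ) (i : ℕ) : ∃ r, IsLift (actionB N i) (liftB N i) r :=
  match i with
  | 0 => ⟨_, isLift_twistHomeo (spiralAngle N) (contDiff_spiralAngle N)⟩
  | 1 => ⟨_, isLift_smallLift (spreadRing N) (norm_spreadRing_sub_le N)⟩
  | _ + 2 => ⟨_, isLift_one⟩

lemma three_le_norm_exp {w : ℂ} (hw : 3 < w.re) : 3 ≤ ‖Complex.exp w‖ := by
  rw [Complex.norm_exp]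
  linarith [Real.add_one_le_exp w.re]

lemma IsDiscMap.isLift_id {f : ℂ ≃ₜ ℂ} (hf : IsDiscMap f) : IsLift f id 3 :=
  ⟨continuousOn_id, fun _ hw => (hf.eq_self _ (three_le_norm_exp hw)).symm, fun _ _ => rfl⟩

lemma isLift_comm (N : ℤ) (i : ℕ) : ∃ r,
    IsLift (actionA i * actionB N i * (actionA i)⁻¹ * (actionB N i)⁻¹ : DiffPlus) id r :=
  match i with
  | 0 => ⟨3, by rw [comm_zero]; exact (isDiscMap_ringTwist N).isLift_id⟩
  | 1 => ⟨3, by rw [comm_one]; exact (isDiscMap_ringTwist_symm N).isLift_id⟩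
  | _ + 2 => ⟨0, by simpa [actionA, actionB] using isLift_one⟩

lemma liftA_liftB (N : ℤ) (i : ℕ) : ∀ᶠ w in rightEnd,
    liftA i (liftB N i w) = liftB N i (liftA i w) + (if i = 0 then N else 0 : ℤ) * deck :=
  match i with
  | 0 => by
    filter_upwards [eventually_re_gt 1] with w hw
    have h1 : 2 ≤ Real.exp (2 * w.re) := by linarith [Real.add_one_le_exp (2 * w.re)]
    have h2 : 2 ≤ Real.exp (2 * (w + 1 / 2).re) := by
      refine h1.trans (Real.exp_le_exp.2 ?_)
      norm_num
    simp only [liftA, liftB, if_pos]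
    -- The two angles are `-2πN · 2 Re w` and `-2πN (2 Re w + 1)`; they differ by `N` full turns.
    rw [spiralAngle_of_two_le N h1, spiralAngle_of_two_le N h2, Real.log_exp, Real.log_exp]
    have h3 : (w + 1 / 2).re = w.re + 1 / 2 := by norm_num
    rw [h3, deck]
    push_cast
    ring
  | 1 => by
    have h : ∀ᶠ w in rightEnd, translation (spreadRing N (Complex.exp w)) =
        spreadRing N (translation (Complex.exp w)) := by
      have ht := (isLift_smallLift translation norm_translation_sub_le).tendsto.comp
        (isLift_smallLift (spreadRing N) (norm_spreadRing_sub_le N)).tendsto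
      filter_upwards [tendsto_rightEnd_iff.1 ht 3,
        tendsto_rightEnd_iff.1
          (isLift_smallLift (spreadRing N) (norm_spreadRing_sub_le N)).tendsto 8,
        eventually_re_gt 6] with w h1 h2 h3
      have h4 : Complex.exp (smallLift translation (smallLift (spreadRing N) w)) =
          translation (spreadRing N (Complex.exp w)) := by
        rw [(isLift_smallLift translation norm_translation_sub_le).exp_eq _ h2,
          (isLift_smallLift (spreadRing N) (norm_spreadRing_sub_le N)).exp_eq _ h3]
      have h5 := three_le_norm_exp h1
      -- `PT = R · TP`, and `R` fixes the point reached by `TP`, which lies outside the disc of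
      -- radius `3`.
      have h6 : spreadRing N (translation (Complex.exp w)) =
          ringTwist N (translation (spreadRing N (Complex.exp w))) :=
        spread_add_eight (isDiscMap_ringTwist N) _
      rw [h6, ← h4]
      exact ((isDiscMap_ringTwist N).eq_self _ h5).symm
    simpa [liftA, liftB] using smallLift_commute translation (spreadRing N)
      norm_translation_sub_le (norm_spreadRing_sub_le N) h
  | _ + 2 => by simp [liftA, liftB]

/-- The action of the surface group of genus `g ≥ 2` on the plane. -/
def action {g : ℕ} (hg : 2 ≤ g) (N : ℤ) : SurfaceGroup g →* DiffPlus :=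
  PresentedGroup.toGroup
    (f := Sum.elim (fun i : Fin g => actionA i) (fun i : Fin g => actionB N i)) (by
      rintro _ rfl
      rw [lift_surfaceRelator]
      obtain ⟨j, rfl⟩ := Nat.exists_eq_add_of_le' hg
      exact commProd_action N j)

lemma eulerNumber_action {g : ℕ} (hg : 2 ≤ g) (N : ℤ) :
    eulerNumber (standardClass g)
      ((Subgroup.inclusion diffPlus_le_homeoPlus).comp (action hg N)) = -N := by
  have hA : (Subgroup.inclusion diffPlus_le_homeoPlus).comp (action hg N) ∘
      surfaceGen g Sum.inl = fun i => Subgroup.inclusion diffPlus_le_homeoPlus (actionA i) := by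
    funext i
    by_cases hi : i < g
    · simp [surfaceGen, hi, action]
    -- Indices `i ≥ g` are at least `2`, where both sides are `1`.
    · obtain ⟨j, rfl⟩ := Nat.exists_eq_add_of_le' (hg.trans (not_lt.1 hi))
      simp [surfaceGen, hi, actionA]
  have hB : (Subgroup.inclusion diffPlus_le_homeoPlus).comp (action hg N) ∘
      surfaceGen g Sum.inr = fun i => Subgroup.inclusion diffPlus_le_homeoPlus (actionB N i) := by
    funext i
    by_cases hi : i < g
    · simp [surfaceGen, hi, action]
    · obtain ⟨j, rfl⟩ := Nat.exists_eq_add_of_le' (hg.trans (not_lt.1 hi))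
      simp [surfaceGen, hi, actionB]
  have hprod : commProd (fun i => Subgroup.inclusion diffPlus_le_homeoPlus (actionA i))
      (fun i => Subgroup.inclusion diffPlus_le_homeoPlus (actionB N i)) g = 1 := by
    rw [← hA, ← hB]
    exact (map_commProd _ _ _ g).symm.trans (by rw [commProd_surfaceGen, map_one])
  rw [eulerNumber_standardClass, hA, hB]
  refine (sum_factorSet_eq (fun i => Subgroup.inclusion diffPlus_le_homeoPlus (actionA i))
    (fun i => Subgroup.inclusion diffPlus_le_homeoPlus (actionB N i)) liftA (liftB N)
    (fun i => if i = 0 then N else 0) isLift_liftA (isLift_liftB N) (isLift_comm N) (liftA_liftB N) g hprod).trans ?_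
  rw [Finset.sum_ite_eq' (Finset.range g) 0 fun _ => N, if_pos (Finset.mem_range.2 (by omega))]

end PlanarEuler

end

/-! ### Passage from the standard class to an arbitrary fundamental class -/

theorem theorem2p7 (g : ℕ) (hg : 2 ≤ g)
    (c : groupHomology.H2 (Rep.trivial ℤ (PlanarEuler.SurfaceGroup g) ℤ))
    (hc : PlanarEuler.IsFundamentalClass g c) (n : ℤ) :
    ∃ ρ : PlanarEuler.SurfaceGroup g →* PlanarEuler.DiffPlus,
      PlanarEuler.eulerNumber c
        ((Subgroup.inclusion PlanarEuler.diffPlus_le_homeoPlus).comp ρ) = n := by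
  have htop : PlanarEuler.standardClass g ∈ Submodule.span ℤ {c} := by
    rw [show Submodule.span ℤ {c} = ⊤ from hc]
    trivial
  obtain ⟨k, hk⟩ := Submodule.mem_span_singleton.1 htop
  have key : ∀ N : ℤ, k * PlanarEuler.eulerNumber c
      ((Subgroup.inclusion PlanarEuler.diffPlus_le_homeoPlus).comp
        (PlanarEuler.action hg N)) = -N := by
    intro N
    rw [← PlanarEuler.eulerNumber_action hg N, ← hk]
    exact (LinearMap.map_smul (PlanarEuler.kronecker _ _) k c).symm
  -- At `N = -1` the right side is `1`, so `k = ±1` and every integer can be reached by choosing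
  -- `N`.
  have hunit : IsUnit k := IsUnit.of_mul_eq_one _ (by simpa using key (-1))
  have hk2 : k * k = 1 := by rcases Int.isUnit_iff.1 hunit with h | h <;> simp [h]
  refine ⟨PlanarEuler.action hg (-(k * n)), ?_⟩
  have := key (-(k * n))
  refine mul_left_cancel₀ hunit.ne_zero (this.trans ?_)
  ring
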